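/- **Setting.** Let $x_1,\dots,x_K\in\mathbb{R}^d$ with $\|x_i\|_2\le 1$ be the feature vectors of $K$ arms and let $\theta_*\in\mathbb{R}^d$. Let $b:\mathbb{R}\to\mathbb{R}$ be twice continuously differentiable, with $\mu=\dot b$ (the mean function) satisfying $\dot\mu>0$, and let $c:\mathbb R\to\mathbb R$ be any function. Put $$\dot\mu_{\min}=\min_{\|x\|_2\le 1,\ \|\theta-\theta_*\|_2\le 1}\dot\mu(x^\top\theta),\qquad \dot\mu_{\max}=\sup_{\|x\|_2\le 1,\ \theta\in\mathbb{R}^d}\dot\mu(x^\top\theta)<\infty .$$ Pulling arm $i$ yields a reward drawn, independently of the past, from a fixed distribution with mean $\mu_i=\mu(x_i^\top\theta_*)$ whose centered version is $\sigma^2$-sub-Gaussian, $\sigma>0$ (for instance from the exponential family with log-partition function $b$). There is a unique optimal arm $i_*$; let $\Delta_i=\mu_{i_*}-\mu_i$, $\Delta_{\max}=\max_i\Delta_i$, and let $R(n)=\sum_{i\ne i_*}\Delta_i\,\mathbb{E}\big[\sum_{t=1}^n \mathbf 1\{I_t=i\}\big]$ be the expected $n$-round regret, where $I_t$ is the arm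 pulled in round $t$, $X_t=x_{I_t}$, and $Y_t$ is the observed reward. Let $G_t=\sum_{\ell=1}^{t-1}X_\ell X_\ell^\top$. **Algorithm (GLM-TSL).** In rounds $t\le\tau$ the arms are chosen by a rule depending only on the previously pulled feature vectors (hence form a fixed sequence). In each round $t\in\{\tau+1,\dots,n\}$, let $\bar\theta_t$ be the maximum likelihood estimate, a minimizer of $\theta\mapsto\sum_{\ell=1}^{t-1}\big(b(X_\ell^\top\theta)-Y_\ell X_\ell^\top\theta-c(Y_\ell)\big)$ (an arbitrary measurable function of the history if there is no minimizer), let $H_t=\sum_{\ell=1}^{t-1}\dot\mu(X_\ell^\top\bar\theta_t)X_\ell X_\ell^\top$, sample $\tilde\theta_t\sim\mathcal N(\bar\theta_t,a^2H_t^{-1})$ given the history of pulled arms and rewards, and pull $I_t\in\arg\max_i x_i^\top\tilde\theta_t$ (ties broken arbitrarily). **Theorem.** For a horizon $n$, let $$c_1=\sigma\dot\mu_{\min}^{-1}\sqrt{d\log(n/d)+2\log n},\quad c_2=c_1\sqrt{2\dot\mu_{\min}^{-1}\dot\mu_{\max}\log(Kn)},\quad a=c_1\sqrt{\dot\mu_{\max}},$$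 and let $\tau\le n$ and the exploration sequence be such that $$\lambda_{\min}(G_\tau)\ \ge\ \max\{\sigma^2\dot\mu_{\min}^{-2}(d\log(n/d)+2\log n),\,1\}.$$ 1. For every $n$ with $1/n<0.15$, $$R(n)\le\dot\mu_{\max}(c_1+c_2)\Big(1+\frac{2}{0.15-1/n}\Big)\sqrt{2dn\log(2n/d)}+(3n+\tau)\Delta_{\max}.$$ 2. The regret is $\tilde O(d\sqrt{n\log K})$ as the horizon grows, up to the exploration cost $\tau\Delta_{\max}$ and with logarithmic factors in $n$ hidden: there are absolute constants $C$ and $p$ such that for every bandit as above there is an $n_0$ such that, for all $n\ge n_0$ and every run of GLM-TSL with $a$, $\tau$ and exploration as above, $$R(n)\le C\,\sigma\dot\mu_{\min}^{-1}\dot\mu_{\max}\sqrt{\dot\mu_{\min}^{-1}\dot\mu_{\max}}\;(\log n)^p\;d\sqrt{n\log K}+\tau\Delta_{\max}.$$ -/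

import Mathlib

open MeasureTheory ProbabilityTheory Filter
open scoped RealInnerProductSpace

noncomputable section

/-- The space `ℝ^d` with its Euclidean norm. -/
abbrev Vec (d : ℕ) := EuclideanSpace ℝ (Fin d)

/-- The rank-one matrix `x xᵀ`. -/
def outer {d : ℕ} (x : Vec d) : Matrix (Fin d) (Fin d) ℝ :=
  Matrix.vecMulVec x.ofLp x.ofLp

/-- The minimum eigenvalue of a (symmetric) real matrix. -/
def lambdaMin {d : ℕ} (M : Matrix (Fin d) (Fin d) ℝ) : ℝ :=
  sInf (spectrum ℝ M)

/-- A stochastic generalized linear bandit with `K` arms in `ℝ^d`.  The negative log likelihood of an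
observation `(x, y)` is `b(xᵀθ) - y xᵀθ - c(y)`, and the mean function is `μ = b'`. -/
structure GLMBandit (d K : ℕ) where
  /-- feature vectors of the arms -/
  x : Fin K → Vec d
  norm_x_le : ∀ i, ‖x i‖ ≤ 1
  /-- the unknown parameter vector -/
  θstar : Vec d
  b : ℝ → ℝ
  c : ℝ → ℝ
  contDiff_b : ContDiff ℝ 2 b
  /-- the derivative of the mean function is positive -/
  deriv_mean_pos : ∀ z, 0 < deriv (deriv b) z
  /-- the derivative of the mean function is bounded, so that its maximum makes sense -/
  bddAbove_deriv_mean : BddAbove {r : ℝ | ∃ u θ : Vec d, ‖u‖ ≤ 1 ∧ r = deriv (deriv b) ⟪u, θ⟫}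
  /-- the reward distribution of each arm -/
  reward : Fin K → Measure ℝ
  isProbabilityMeasure_reward : ∀ i, IsProbabilityMeasure (reward i)
  integrable_reward : ∀ i, Integrable (fun y : ℝ => y) (reward i)
  integral_reward : ∀ i, ∫ y, y ∂(reward i) = deriv b ⟪x i, θstar⟫
  σ : ℝ
  σ_pos : 0 < σ
  /-- the reward noise is `σ²`-sub-Gaussian -/
  subgaussian_reward : ∀ i,
    HasSubgaussianMGF (fun y : ℝ => y - deriv b ⟪x i, θstar⟫) (Real.toNNReal (σ ^ 2)) (reward i)
  /-- the unique optimal arm -/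
  best : Fin K
  best_unique : ∀ i, i ≠ best → deriv b ⟪x i, θstar⟫ < deriv b ⟪x best, θstar⟫

/-- The arms pulled and the rewards observed in rounds `1, …, t - 1`. -/
abbrev History (K t : ℕ) := ↥(Finset.Ico 1 t) → Fin K × ℝ

/-- The random history at the beginning of round `t`. -/
def historyAt {K : ℕ} {Ω : Type*} (I : ℕ → Ω → Fin K) (Y : ℕ → Ω → ℝ) (t : ℕ) (ω : Ω) :
    History K t :=
  fun l => (I l ω, Y l ω)

namespace GLMBandit

variable {d K : ℕ} (B : GLMBandit d K)

/-- The mean function `μ = b'`. -/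
def μ : ℝ → ℝ := deriv B.b

/-- The mean reward `μ_i = μ(x_iᵀ θ_*)` of arm `i`. -/
def meanReward (i : Fin K) : ℝ := B.μ ⟪B.x i, B.θstar⟫

/-- The gap of arm `i`. -/
def gap (i : Fin K) : ℝ := B.meanReward B.best - B.meanReward i

/-- The maximum gap. -/
def gapMax : ℝ := ⨆ i : Fin K, B.gap i

/-- The minimum derivative of `μ` in the unit ball centered at `θ_*`. -/
def μdotMin : ℝ :=
  sInf {r : ℝ | ∃ u θ : Vec d, ‖u‖ ≤ 1 ∧ ‖θ - B.θstar‖ ≤ 1 ∧ r = deriv B.μ ⟪u, θ⟫}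

/-- The maximum derivative of `μ`. -/
def μdotMax : ℝ :=
  sSup {r : ℝ | ∃ u θ : Vec d, ‖u‖ ≤ 1 ∧ r = deriv B.μ ⟪u, θ⟫}

/-- The negative log likelihood of a history under parameter vector `θ`. -/
def negLogLik {t : ℕ} (h : History K t) (θ : Vec d) : ℝ :=
  ∑ l, (B.b ⟪B.x (h l).1, θ⟫ - (h l).2 * ⟪B.x (h l).1, θ⟫ - B.c (h l).2)

/-- The Hessian `∑_{l < t} μ'(X_lᵀ θ) X_l X_lᵀ` of the negative log likelihood of a history. -/
def hessian {t : ℕ} (h : History K t) (θ : Vec d) : Matrix (Fin d) (Fin d) ℝ :=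
  ∑ l, deriv B.μ ⟪B.x (h l).1, θ⟫ • outer (B.x (h l).1)

/-- The unweighted Hessian `G_t = ∑_{l < t} X_l X_lᵀ` of a sequence of arms pulled in rounds
`1, 2, …`. -/
def gram (e : ℕ → Fin K) (t : ℕ) : Matrix (Fin d) (Fin d) ℝ :=
  ∑ l ∈ Finset.Ico 1 t, outer (B.x (e l))

/-- The reward distribution, given the history and the arm that is pulled. -/
def rewardKernel (t : ℕ) : Kernel (History K t × Fin K) ℝ :=
  Kernel.prodMkLeft (History K t) (Kernel.ofFunOfCountable B.reward)

/-- The expected `n`-round regret of the pulled arms `I_1, …, I_n`. -/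
def regret {Ω : Type*} [MeasurableSpace Ω] (P : Measure Ω) (I : ℕ → Ω → Fin K) (n : ℕ) : ℝ :=
  ∑ i ∈ Finset.univ.erase B.best,
    B.gap i * ∫ ω, (∑ t ∈ Finset.Icc 1 n, if I t ω = i then (1 : ℝ) else 0) ∂P

/-- An `n`-round execution of GLM-TSL with tunable parameter `a`, on a probability space `(Ω, P)`.
The arms in the first `τ` rounds are `explore 1, …, explore τ`.  Here `I t` is the arm pulled in
round `t`, `Y t` is its reward, `θhat t` maps the history at the beginning of round `t` to the
maximum likelihood estimate, and `θtilde t` is the sampled parameter vector.  If the likelihood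
has no maximizer, `θhat` is unrestricted (apart from measurability); ties are broken arbitrarily. -/
structure IsGLMTSL (n τ : ℕ) (a : ℝ) (explore : ℕ → Fin K)
    {Ω : Type*} [MeasurableSpace Ω] (P : Measure Ω)
    (I : ℕ → Ω → Fin K) (Y : ℕ → Ω → ℝ)
    (θhat : (t : ℕ) → History K t → Vec d) (θtilde : ℕ → Ω → Vec d) : Prop where
  measurable_I : ∀ t, Measurable (I t)
  measurable_Y : ∀ t, Measurable (Y t)
  measurable_θhat : ∀ t, Measurable (θhat t)
  measurable_θtilde : ∀ t, Measurable (θtilde t)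
  /-- given the history and the pulled arm, the reward has the distribution of that arm -/
  reward_law : ∀ t ∈ Finset.Icc 1 n,
    HasCondDistrib (Y t) (fun ω => (historyAt I Y t ω, I t ω)) (B.rewardKernel t) P
  /-- initial exploration -/
  explore_eq : ∀ t ∈ Finset.Icc 1 n, t ≤ τ → ∀ᵐ ω ∂P, I t ω = explore t
  /-- maximum likelihood estimation -/
  mle : ∀ t ∈ Finset.Icc 1 n, τ < t → ∀ᵐ ω ∂P,
    (∃ θ, ∀ θ', B.negLogLik (historyAt I Y t ω) θ ≤ B.negLogLik (historyAt I Y t ω) θ') →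
    ∀ θ', B.negLogLik (historyAt I Y t ω) (θhat t (historyAt I Y t ω)) ≤
      B.negLogLik (historyAt I Y t ω) θ'
  /-- given the history, the parameter vector is sampled from the Laplace approximation -/
  sampling : ∀ t ∈ Finset.Icc 1 n, τ < t → ∃ κ : Kernel (History K t) (Vec d),
    (∀ h, κ h = multivariateGaussian (θhat t h) (a ^ 2 • (B.hessian h (θhat t h))⁻¹)) ∧
    HasCondDistrib (θtilde t) (historyAt I Y t) κ P
  /-- the arm with the highest estimated reward is pulled -/
  greedy : ∀ t ∈ Finset.Icc 1 n, τ < t → ∀ᵐ ω ∂P, ∀ i,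
    ⟪B.x i, θtilde t ω⟫ ≤ ⟪B.x (I t ω), θtilde t ω⟫

/-- The constant `c₁ = σ μ'_min⁻¹ √(d log(n/d) + 2 log n)`. -/
def c₁ (n : ℕ) : ℝ :=
  B.σ * B.μdotMin⁻¹ * √(d * Real.log (n / d) + 2 * Real.log n)

/-- The constant `c₂ = c₁ √(2 μ'_min⁻¹ μ'_max log(Kn))`. -/
def c₂ (n : ℕ) : ℝ :=
  B.c₁ n * √(2 * B.μdotMin⁻¹ * B.μdotMax * Real.log (K * n))

/-- The tunable parameter `a = c₁ √μ'_max`. -/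
def tuning (n : ℕ) : ℝ := B.c₁ n * √B.μdotMax

/-- The requirement on the number `τ` of initial exploration rounds. -/
def SufficientExploration (n τ : ℕ) (explore : ℕ → Fin K) : Prop :=
  τ ≤ n ∧
    max (B.σ ^ 2 * (B.μdotMin ^ 2)⁻¹ * (d * Real.log (n / d) + 2 * Real.log n)) 1 ≤
      lambdaMin (B.gram explore τ)

end GLMBandit

end

/-! ### Quadratic forms of symmetric matrices -/

/-! The two claims differ greatly in depth. In the first, the additive term (3n+τ)Δmax already
exceeds the trivial bound nΔmax of `regret_le_mul_gapMax`, and the leading term is nonnegative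
because 1/n < 0.15.

The second claim is the genuine Thompson-sampling analysis. Write G for the Gram matrix of the
pulled features, S for the score at θ_*, and w_i for the norm of x_i in G⁻¹. For a fixed direction
v, exp(⟨v,S⟩ − (σ²/2)vᵀGv) has expectation at most 1, even though arms are chosen adaptively
(`lintegral_exp_expo_le`). A union bound over a finite grid of directions, followed by rounding
(`inner_noise_le_of_concentrated`), gives ⟨u,S⟩ ≤ s√(uᵀGu) for all u at once. Convexity of the
negative log likelihood and the exploration requirement then place the maximum likelihood estimate
in the unit ball about θ_*, with error at most c₁ in the G-norm (`norm_sub_le_of_minimizer`).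

On such a history the Gaussian sample is within c₂w_i of the estimate for every arm with probability
at least 1 − 2/n, and it is optimistic for the best arm with probability at least P(N(0,1) ≥ 1).
Call an arm undersampled if its linear gap is at most (c₁+c₂)w_i, and let the lead be the least
uncertain undersampled arm. The gap of the pulled arm is controlled by its own width and that of the
lead (`linGap_le`). An optimistic, accurate sample forces the pulled arm to be undersampled, hence
at least as wide as the lead (`leadWidth_le`). So the expected lead width is at most a constant
times the expected pulled width (`integral_gap_le`), and Cauchy–Schwarz with the elliptical
potential lemma sums the pulled widths to √(2dn log n).

The grid union bound leaves a failure probability of order n^(−1/2) per round, hence a cost of order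
√n with a factor exponential in d. This is absorbed by a logarithm once n is large for the given
bandit. The threshold may also exceed K, so log(Kn) ≤ 2 log n, and √(log K) in the conclusion costs
only the constant log K ≥ 1/4. -/

open Matrix in
/-- The quadratic form `uᵀ M u`. -/
noncomputable def quadForm {d : ℕ} (M : Matrix (Fin d) (Fin d) ℝ) (u : Vec d) : ℝ :=
  u.ofLp ⬝ᵥ M *ᵥ u.ofLp

section LinearAlgebra

open Matrix

variable {d : ℕ}

theorem inner_eq_dotProduct (u v : Vec d) : ⟪u, v⟫ = u.ofLp ⬝ᵥ v.ofLp := by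
  simp [PiLp.inner_apply, dotProduct, mul_comm]

theorem quadForm_outer (x u : Vec d) : quadForm (outer x) u = ⟪x, u⟫ ^ 2 := by
  rw [quadForm, outer, vecMulVec_mulVec, inner_eq_dotProduct]
  simp [dotProduct_smul, pow_two, dotProduct_comm]

theorem quadForm_add (M N : Matrix (Fin d) (Fin d) ℝ) (u : Vec d) :
    quadForm (M + N) u = quadForm M u + quadForm N u := by
  simp [quadForm, add_mulVec, dotProduct_add]

theorem quadForm_smul (c : ℝ) (M : Matrix (Fin d) (Fin d) ℝ) (u : Vec d) :
    quadForm (c • M) u = c * quadForm M u := by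
  simp [quadForm, smul_mulVec, dotProduct_smul]

theorem quadForm_sum {ι : Type*} (s : Finset ι) (M : ι → Matrix (Fin d) (Fin d) ℝ) (u : Vec d) :
    quadForm (∑ i ∈ s, M i) u = ∑ i ∈ s, quadForm (M i) u := by
  classical
  induction s using Finset.induction_on with
  | empty => simp [quadForm]
  | insert a s ha ih => rw [Finset.sum_insert ha, Finset.sum_insert ha, quadForm_add, ih]

theorem quadForm_smul_right (M : Matrix (Fin d) (Fin d) ℝ) (c : ℝ) (u : Vec d) :
    quadForm M (c • u) = c ^ 2 * quadForm M u := by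
  simp [quadForm, mulVec_smul, dotProduct_smul]; ring

theorem isHermitian_outer (x : Vec d) : (outer x).IsHermitian := by
  ext i j; simp [outer, vecMulVec_apply, mul_comm]

theorem isHermitian_sum_smul_outer {ι : Type*} (s : Finset ι) (c : ι → ℝ) (x : ι → Vec d) :
    (∑ i ∈ s, c i • outer (x i)).IsHermitian := by
  rw [IsHermitian, conjTranspose_sum]
  refine Finset.sum_congr rfl fun i _ => ?_
  rw [conjTranspose_smul, (isHermitian_outer (x i)).eq]; simp

theorem posDef_of_quadForm_pos {M : Matrix (Fin d) (Fin d) ℝ} (hM : M.IsHermitian)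
    (h : ∀ u : Vec d, u ≠ 0 → 0 < quadForm M u) : M.PosDef := by
  refine PosDef.of_dotProduct_mulVec_pos hM fun x hx => ?_
  have := h (WithLp.toLp 2 x) (by simpa using hx)
  simpa [quadForm] using this

theorem Matrix.PosDef.quadForm_pos {M : Matrix (Fin d) (Fin d) ℝ} (hM : M.PosDef) {u : Vec d}
    (hu : u ≠ 0) : 0 < quadForm M u := by
  have := hM.dotProduct_mulVec_pos (x := u.ofLp) (by simpa using hu)
  simpa [quadForm] using this

theorem Matrix.PosDef.quadForm_nonneg {M : Matrix (Fin d) (Fin d) ℝ} (hM : M.PosDef) (u : Vec d) :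
    0 ≤ quadForm M u := by
  have := hM.posSemidef.dotProduct_mulVec_nonneg u.ofLp
  simpa [quadForm] using this

/-- Subtracting the least spectral value times the identity shifts every eigenvalue to a nonnegative
one. The spectrum is finite, so the infimum is a true lower bound; in dimension zero there is no
eigenvalue to check. -/
theorem lambdaMin_mul_le_quadForm {M : Matrix (Fin d) (Fin d) ℝ} (hM : M.IsHermitian) (u : Vec d) :
    lambdaMin M * ‖u‖ ^ 2 ≤ quadForm M u := by
  have h0 : (M - lambdaMin M • (1 : Matrix (Fin d) (Fin d) ℝ)).PosSemidef := by
    have hH : (M - lambdaMin M • (1 : Matrix (Fin d) (Fin d) ℝ)).IsHermitian := by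
      refine hM.sub ?_
      rw [IsHermitian, conjTranspose_smul]; simp
    rw [hH.posSemidef_iff_eigenvalues_nonneg]
    intro i
    have h1 : hH.eigenvalues i ∈ spectrum ℝ (M - lambdaMin M • (1 : Matrix (Fin d) (Fin d) ℝ)) :=
      hH.eigenvalues_mem_spectrum_real i
    have h2 : hH.eigenvalues i + lambdaMin M ∈ spectrum ℝ M := by
      have h3 := spectrum.add_mem_add_iff (R := ℝ) (s := lambdaMin M) |>.2 h1
      rw [Algebra.algebraMap_eq_smul_one] at h3
      simpa using h3
    have h3 : BddBelow (spectrum ℝ M) := by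
      rw [hM.spectrum_real_eq_range_eigenvalues]
      exact (Set.finite_range _).bddBelow
    have := csInf_le h3 h2
    simp only [lambdaMin, Pi.zero_apply] at this ⊢
    linarith
  have h1 := h0.dotProduct_mulVec_nonneg u.ofLp
  simp only [star_trivial, sub_mulVec, smul_mulVec, one_mulVec, dotProduct_sub,
    dotProduct_smul, smul_eq_mul] at h1
  have h2 : ‖u‖ ^ 2 = u.ofLp ⬝ᵥ u.ofLp := by
    rw [← inner_eq_dotProduct, real_inner_self_eq_norm_sq]
  rw [h2]
  simpa [quadForm] using h1

theorem quadForm_add_vec {M : Matrix (Fin d) (Fin d) ℝ} (hM : M.IsHermitian) (u v : Vec d) :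
    quadForm M (u + v) = quadForm M u + 2 * (u.ofLp ⬝ᵥ M *ᵥ v.ofLp) + quadForm M v := by
  have : v.ofLp ⬝ᵥ M *ᵥ u.ofLp = u.ofLp ⬝ᵥ M *ᵥ v.ofLp := by
    rw [dotProduct_mulVec, ← mulVec_transpose, dotProduct_comm]
    have : Mᵀ = M := by simpa using hM.eq
    rw [this]
  simp only [quadForm, WithLp.ofLp_add, mulVec_add, dotProduct_add, add_dotProduct, this]
  ring

/-- The Cauchy–Schwarz inequality for a positive definite matrix. -/
theorem dotProduct_mulVec_sq_le {M : Matrix (Fin d) (Fin d) ℝ} (hM : M.PosDef) (u v : Vec d) :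
    (u.ofLp ⬝ᵥ M *ᵥ v.ofLp) ^ 2 ≤ quadForm M u * quadForm M v := by
  have h : ∀ t : ℝ, 0 ≤ quadForm M v * (t * t) + (2 * (u.ofLp ⬝ᵥ M *ᵥ v.ofLp)) * t
      + quadForm M u := by
    intro t
    have h1 := hM.quadForm_nonneg (u + t • v)
    rw [quadForm_add_vec hM.1, quadForm_smul_right] at h1
    simp only [WithLp.ofLp_smul, mulVec_smul, dotProduct_smul, smul_eq_mul] at h1
    linarith
  have := discrim_le_zero h
  rw [discrim] at this
  nlinarith

/-- Cauchy–Schwarz for M⁻¹, applied to x and Mu. It converts an estimation error in the M-norm into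
a confidence width along a feature vector. -/
theorem inner_sq_le_quadForm_inv {M : Matrix (Fin d) (Fin d) ℝ} (hM : M.PosDef) (x u : Vec d) :
    ⟪x, u⟫ ^ 2 ≤ quadForm M⁻¹ x * quadForm M u := by
  have h := dotProduct_mulVec_sq_le hM.inv x (WithLp.toLp 2 (M *ᵥ u.ofLp))
  have hdet : IsUnit M.det := isUnit_iff_ne_zero.2 hM.det_pos.ne'
  have h1 : M⁻¹ *ᵥ (M *ᵥ u.ofLp) = u.ofLp := by
    rw [mulVec_mulVec, nonsing_inv_mul _ hdet, one_mulVec]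
  have h2 : quadForm M⁻¹ (WithLp.toLp 2 (M *ᵥ u.ofLp)) = quadForm M u := by
    simp [quadForm, h1, dotProduct_comm]
  rw [h2] at h
  simpa [h1, inner_eq_dotProduct] using h

/-- Inversion reverses the order of positive definite matrices. Testing the duality inequality at
N⁻¹x reduces this to cancelling one factor of xᵀN⁻¹x. -/
theorem quadForm_inv_le {M N : Matrix (Fin d) (Fin d) ℝ} (hM : M.PosDef) (hN : N.PosDef) {c : ℝ}
    (hc : 0 ≤ c) (h : ∀ u, quadForm M u ≤ c * quadForm N u) (x : Vec d) :
    quadForm N⁻¹ x ≤ c * quadForm M⁻¹ x := by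
  have hdet : IsUnit N.det := isUnit_iff_ne_zero.2 hN.det_pos.ne'
  set D : Vec d := WithLp.toLp 2 (N⁻¹ *ᵥ x.ofLp)
  have h1 : ⟪x, D⟫ = quadForm N⁻¹ x := by simp [inner_eq_dotProduct, quadForm, D]
  have h2 : quadForm N D = quadForm N⁻¹ x := by
    simp [quadForm, D, mul_nonsing_inv _ hdet, dotProduct_comm]
  have h3 := inner_sq_le_quadForm_inv hM x D
  have h4 := h D
  rw [h1] at h3
  rw [h2] at h4
  have h5 := hM.inv.quadForm_nonneg x
  rcases (hN.inv.quadForm_nonneg x).eq_or_lt with h6 | h6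
  · rw [← h6]; positivity
  · have : quadForm N⁻¹ x ^ 2 ≤ (c * quadForm M⁻¹ x) * quadForm N⁻¹ x := by
      refine h3.trans ?_
      calc _ ≤ quadForm M⁻¹ x * (c * quadForm N⁻¹ x) := by gcongr
        _ = _ := by ring
    rw [pow_two] at this
    exact le_of_mul_le_mul_right this h6

theorem det_add_outer {M : Matrix (Fin d) (Fin d) ℝ} (hM : IsUnit M.det) (x : Vec d) :
    (M + outer x).det = M.det * (1 + quadForm M⁻¹ x) := by
  have h := det_add_replicateCol_mul_replicateRow (ι := Unit) hM x.ofLp x.ofLp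
  have h1 : replicateCol Unit x.ofLp * replicateRow Unit x.ofLp = outer x := by
    ext i j; simp [outer, vecMulVec_apply, mul_apply]
  rw [h1] at h
  rw [h, det_unique (n := Unit), Matrix.mul_assoc]
  simp [quadForm, mul_apply, dotProduct, mulVec]

/-- Each positive eigenvalue is at most their sum. This is cruder than the arithmetic–geometric mean
inequality, but the loss is only inside a logarithm. -/
theorem Matrix.PosDef.det_le_trace_pow {M : Matrix (Fin d) (Fin d) ℝ} (hM : M.PosDef) :
    M.det ≤ M.trace ^ d := by
  rw [hM.1.det_eq_prod_eigenvalues, hM.1.trace_eq_sum_eigenvalues]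
  have : ∀ i, hM.1.eigenvalues i ≤ ∑ j, hM.1.eigenvalues j := fun i =>
    Finset.single_le_sum (f := hM.1.eigenvalues) (fun j _ => (hM.eigenvalues_pos j).le)
      (Finset.mem_univ i)
  calc ∏ i, hM.1.eigenvalues i ≤ ∏ _i : Fin d, ∑ j, hM.1.eigenvalues j :=
        Finset.prod_le_prod (fun i _ => (hM.eigenvalues_pos i).le) fun i _ => this i
    _ = _ := by simp

theorem one_le_det_of_sq_le_quadForm {M : Matrix (Fin d) (Fin d) ℝ} (hM : M.IsHermitian)
    (h : ∀ u, ‖u‖ ^ 2 ≤ quadForm M u) : 1 ≤ M.det := by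
  rw [hM.det_eq_prod_eigenvalues]
  have h1 : ∀ i, 1 ≤ hM.eigenvalues i := by
    intro i
    have h2 := h (hM.eigenvectorBasis i)
    rw [quadForm, hM.mulVec_eigenvectorBasis, dotProduct_smul, ← inner_eq_dotProduct,
      real_inner_self_eq_norm_sq] at h2
    simpa using h2
  have := Finset.prod_le_prod (s := Finset.univ) (f := fun _ : Fin d => (1 : ℝ))
    (g := hM.eigenvalues) (fun _ _ => zero_le_one) fun i _ => h1 i
  simpa using this

theorem trace_outer (x : Vec d) : (outer x).trace = ‖x‖ ^ 2 := by
  rw [← real_inner_self_eq_norm_sq, inner_eq_dotProduct, outer, trace_vecMulVec]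

theorem posDef_of_sq_norm_le {M : Matrix (Fin d) (Fin d) ℝ} (hM : M.IsHermitian)
    (h : ∀ u : Vec d, ‖u‖ ^ 2 ≤ quadForm M u) : M.PosDef :=
  posDef_of_quadForm_pos hM fun u hu => lt_of_lt_of_le (by positivity) (h u)

theorem quadForm_inv_le_sq_norm {M : Matrix (Fin d) (Fin d) ℝ} (hM : M.IsHermitian)
    (h : ∀ u, ‖u‖ ^ 2 ≤ quadForm M u) (x : Vec d) : quadForm M⁻¹ x ≤ ‖x‖ ^ 2 := by
  have h1 : quadForm M⁻¹ x ≤ 1 * quadForm (1 : Matrix (Fin d) (Fin d) ℝ)⁻¹ x := by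
    refine quadForm_inv_le PosDef.one (posDef_of_sq_norm_le hM h) zero_le_one (fun u => ?_) _
    rw [one_mul]
    refine le_trans (le_of_eq ?_) (h u)
    simp [quadForm, ← inner_eq_dotProduct]
  have h2 : quadForm (1 : Matrix (Fin d) (Fin d) ℝ)⁻¹ x = ‖x‖ ^ 2 := by
    simp [quadForm, ← inner_eq_dotProduct]
  rwa [h2, one_mul] at h1

/-- The elliptical potential lemma. -/
theorem sum_quadForm_inv_le (M : ℕ → Matrix (Fin d) (Fin d) ℝ) (x : ℕ → Vec d)
    (hx : ∀ t, ‖x t‖ ≤ 1) {τ n : ℕ} (hτn : τ ≤ n)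
    (hstep : ∀ t, τ ≤ t → M (t + 1) = M t + outer (x t))
    (hH : ∀ t, (M t).IsHermitian) (hpos : ∀ t, τ ≤ t → ∀ u, ‖u‖ ^ 2 ≤ quadForm (M t) u) :
    ∑ t ∈ Finset.Ico τ n, quadForm (M t)⁻¹ (x t) ≤ 2 * Real.log (M n).det := by
  have hPD : ∀ t, τ ≤ t → (M t).PosDef := fun t ht => posDef_of_sq_norm_le (hH t) (hpos t ht)
  induction n, hτn using Nat.le_induction with
  | base =>
    simpa using Real.log_nonneg (one_le_det_of_sq_le_quadForm (hH τ) (hpos τ le_rfl))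
  | succ n hn ih =>
    rw [Finset.sum_Ico_succ_top hn, hstep n hn]
    have hd := (hPD n hn).det_pos
    rw [det_add_outer (isUnit_iff_ne_zero.2 hd.ne')]
    have hq := (hPD n hn).inv.quadForm_nonneg (x n)
    rw [Real.log_mul hd.ne' (by positivity)]
    have hq1 : quadForm (M n)⁻¹ (x n) ≤ 1 := by
      have h1 := quadForm_inv_le_sq_norm (hH n) (hpos n hn) (x n)
      have := hx n
      nlinarith [norm_nonneg (x n)]
    -- With q = xᵀM⁻¹x ≤ 1, one has q/2 ≤ q/(1+q) = 1 − 1/(1+q) ≤ log(1+q). The increments log(1+q)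
    -- telescope to the log determinant.
    have hlog : quadForm (M n)⁻¹ (x n) / 2 ≤ Real.log (1 + quadForm (M n)⁻¹ (x n)) := by
      have h1 := Real.one_sub_inv_le_log_of_pos (x := 1 + quadForm (M n)⁻¹ (x n)) (by positivity)
      refine le_trans ?_ h1
      rw [← sub_nonneg]
      have : 1 - (1 + quadForm (M n)⁻¹ (x n))⁻¹ - quadForm (M n)⁻¹ (x n) / 2
          = quadForm (M n)⁻¹ (x n) * (1 - quadForm (M n)⁻¹ (x n))
            / (2 * (1 + quadForm (M n)⁻¹ (x n))) := by
        field_simp; ring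
      rw [this]
      have : 0 ≤ 1 - quadForm (M n)⁻¹ (x n) := by linarith
      positivity
    linarith

end LinearAlgebra

/-! ### The score at the true parameter vector and its exponential supermartingale -/

namespace GLMBandit

variable {d K : ℕ} (B : GLMBandit d K)

/-- The score `∑ (Y_l - μ(X_lᵀ θ_*)) X_l` of a history at the true parameter vector. -/
noncomputable def noise {t : ℕ} (h : History K t) : Vec d :=
  ∑ l, ((h l).2 - B.meanReward (h l).1) • B.x (h l).1

/-- The matrix `∑ X_l X_lᵀ` of a history. -/
noncomputable def histGram {t : ℕ} (h : History K t) : Matrix (Fin d) (Fin d) ℝ :=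
  ∑ l, outer (B.x (h l).1)

section Measurability

variable {t : ℕ}

theorem measurable_arm_comp {α : Type*} [MeasurableSpace α] (f : Fin K → α)
    (l : ↥(Finset.Ico 1 t)) : Measurable fun h : History K t => f (h l).1 :=
  (measurable_of_countable f).comp (measurable_fst.comp (measurable_pi_apply l))

theorem measurable_reward_apply (l : ↥(Finset.Ico 1 t)) :
    Measurable fun h : History K t => (h l).2 :=
  measurable_snd.comp (measurable_pi_apply l)

theorem measurable_noise : Measurable (B.noise (t := t)) := by
  unfold noise
  refine Finset.measurable_sum _ fun l _ => ?_
  exact ((measurable_reward_apply l).sub (measurable_arm_comp B.meanReward l)).smul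
    (measurable_arm_comp B.x l)

/-- There are only finitely many arm sequences, so every function of them is measurable. This covers
quantities defined by choice, such as `leadWidth`, and events quantified over all directions. -/
theorem measurable_comp_arms {α : Type*} [MeasurableSpace α]
    (f : (↥(Finset.Ico 1 t) → Fin K) → α) :
    Measurable fun h : History K t => f fun l => (h l).1 :=
  (measurable_of_countable f).comp
    (measurable_pi_lambda _ fun l => measurable_fst.comp (measurable_pi_apply l))

theorem measurable_comp_histGram {α : Type*} [MeasurableSpace α]
    (f : Matrix (Fin d) (Fin d) ℝ → α) :
    Measurable fun h : History K t => f (B.histGram h) :=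
  measurable_comp_arms fun e => f (∑ l, outer (B.x (e l)))

variable {Ω : Type*} [MeasurableSpace Ω] {I : ℕ → Ω → Fin K} {Y : ℕ → Ω → ℝ}

theorem measurable_historyAt (hI : ∀ t, Measurable (I t)) (hY : ∀ t, Measurable (Y t)) (t : ℕ) :
    Measurable (historyAt I Y t) :=
  measurable_pi_lambda _ fun l => (hI l).prodMk (hY l)

end Measurability

theorem histGram_historyAt {Ω : Type*} (I : ℕ → Ω → Fin K) (Y : ℕ → Ω → ℝ) (t : ℕ) (ω : Ω) :
    B.histGram (historyAt I Y t ω) = B.gram (fun l => I l ω) t := by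
  simp only [histGram, historyAt, gram]
  exact Finset.sum_coe_sort (Finset.Ico 1 t) fun l => outer (B.x (I l ω))

theorem noise_historyAt {Ω : Type*} (I : ℕ → Ω → Fin K) (Y : ℕ → Ω → ℝ) (t : ℕ) (ω : Ω) :
    B.noise (historyAt I Y t ω) =
      ∑ l ∈ Finset.Ico 1 t, (Y l ω - B.meanReward (I l ω)) • B.x (I l ω) := by
  simp only [noise, historyAt]
  exact Finset.sum_coe_sort (Finset.Ico 1 t)
    fun l => (Y l ω - B.meanReward (I l ω)) • B.x (I l ω)

theorem gram_succ (e : ℕ → Fin K) {t : ℕ} (ht : 1 ≤ t) :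
    B.gram e (t + 1) = B.gram e t + outer (B.x (e t)) := by
  simp only [gram]; rw [Finset.sum_Ico_succ_top ht]

theorem quadForm_histGram {t : ℕ} (h : History K t) (u : Vec d) :
    quadForm (B.histGram h) u = ∑ l, ⟪B.x (h l).1, u⟫ ^ 2 := by
  simp [histGram, quadForm_sum, quadForm_outer]

theorem isHermitian_histGram {t : ℕ} (h : History K t) : (B.histGram h).IsHermitian := by
  have := isHermitian_sum_smul_outer Finset.univ (fun _ => (1 : ℝ)) fun l => B.x (h l).1
  simpa [histGram] using this

theorem quadForm_histGram_le {t : ℕ} (h : History K t) (u : Vec d) :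
    quadForm (B.histGram h) u ≤ t * ‖u‖ ^ 2 := by
  rw [quadForm_histGram]
  calc ∑ l, ⟪B.x (h l).1, u⟫ ^ 2 ≤ ∑ _l : ↥(Finset.Ico 1 t), ‖u‖ ^ 2 := by
        refine Finset.sum_le_sum fun l _ => ?_
        refine sq_le_sq' ?_ ?_
        · have := (abs_le.1 (abs_real_inner_le_norm (B.x (h l).1) u)).1
          nlinarith [B.norm_x_le (h l).1, norm_nonneg u, norm_nonneg (B.x (h l).1)]
        · have := (abs_le.1 (abs_real_inner_le_norm (B.x (h l).1) u)).2
          nlinarith [B.norm_x_le (h l).1, norm_nonneg u, norm_nonneg (B.x (h l).1)]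
    _ = ((t - 1 : ℕ) : ℝ) * ‖u‖ ^ 2 := by simp
    _ ≤ _ := by gcongr; omega

/-- The exponent of the supermartingale. -/
noncomputable def expo (v : Vec d) {t : ℕ} (h : History K t) : ℝ :=
  ⟪v, B.noise h⟫ - B.σ ^ 2 / 2 * quadForm (B.histGram h) v

theorem measurable_expo (v : Vec d) (t : ℕ) : Measurable (B.expo v (t := t)) := by
  unfold expo
  exact ((measurable_const (a := v)).inner B.measurable_noise).sub
    ((B.measurable_comp_histGram fun M => quadForm M v).const_mul _)

/-- The sub-Gaussian moment bound at ⟨v, x_i⟩: the quadratic compensator cancels it exactly. This is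
one step of the supermartingale. -/
theorem lintegral_exp_reward_le (i : Fin K) (v : Vec d) :
    ∫⁻ y, ENNReal.ofReal (Real.exp (⟪v, B.x i⟫ * (y - B.meanReward i)
      - B.σ ^ 2 / 2 * ⟪v, B.x i⟫ ^ 2)) ∂(B.reward i) ≤ 1 := by
  have hs := B.subgaussian_reward i
  have hint := hs.integrable_exp_mul ⟪v, B.x i⟫
  have hle := hs.mgf_le ⟪v, B.x i⟫
  rw [mgf] at hle
  have e : ∀ y : ℝ, Real.exp (⟪v, B.x i⟫ * (y - B.meanReward i)
      - B.σ ^ 2 / 2 * ⟪v, B.x i⟫ ^ 2) =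
      Real.exp (⟪v, B.x i⟫ * (y - deriv B.b ⟪B.x i, B.θstar⟫)) *
        Real.exp (- (B.σ ^ 2 / 2 * ⟪v, B.x i⟫ ^ 2)) := by
    intro y; rw [← Real.exp_add]; rfl
  simp_rw [e]
  rw [← ofReal_integral_eq_lintegral_ofReal (hint.mul_const _)
    (Eventually.of_forall fun y => by positivity), integral_mul_const]
  rw [ENNReal.ofReal_le_one]
  rw [Real.exp_neg, ← div_eq_mul_inv, div_le_one (Real.exp_pos _)]
  refine hle.trans (le_of_eq ?_)
  rw [Real.coe_toNNReal _ (sq_nonneg _)]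
  congr 1; ring

theorem expo_historyAt_succ {Ω : Type*} (I : ℕ → Ω → Fin K) (Y : ℕ → Ω → ℝ)
    (v : Vec d) {t : ℕ} (ht : 1 ≤ t) (ω : Ω) :
    B.expo v (historyAt I Y (t + 1) ω) = B.expo v (historyAt I Y t ω) +
      (⟪v, B.x (I t ω)⟫ * (Y t ω - B.meanReward (I t ω))
        - B.σ ^ 2 / 2 * ⟪v, B.x (I t ω)⟫ ^ 2) := by
  simp only [expo, noise_historyAt, histGram_historyAt]
  rw [gram_succ _ _ ht, Finset.sum_Ico_succ_top ht, quadForm_add, quadForm_outer, inner_add_right,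
    real_inner_smul_right, real_inner_comm v]
  ring

variable {Ω : Type*} [MeasurableSpace Ω] {P : Measure Ω} [IsProbabilityMeasure P]
  {I : ℕ → Ω → Fin K} {Y : ℕ → Ω → ℝ} {n τ : ℕ} {a : ℝ} {explore : ℕ → Fin K}
  {θhat : (t : ℕ) → History K t → Vec d} {θtilde : ℕ → Ω → Vec d}

instance (t : ℕ) : IsMarkovKernel (B.rewardKernel t) := by
  have : IsMarkovKernel (Kernel.ofFunOfCountable B.reward : Kernel (Fin K) ℝ) :=
    ⟨fun i => B.isProbabilityMeasure_reward i⟩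
  unfold rewardKernel; infer_instance

/-- The expectation starts at 1 and cannot increase: given the history and the pulled arm, the new
factor integrates to at most 1. Only the conditional law of the reward enters, so the rule that
selects arms is irrelevant. -/
theorem lintegral_exp_expo_le {B : GLMBandit d K}
    (hB : B.IsGLMTSL n τ a explore P I Y θhat θtilde) (v : Vec d) {t : ℕ} (ht : 1 ≤ t)
    (htn : t ≤ n + 1) :
    ∫⁻ ω, ENNReal.ofReal (Real.exp (B.expo v (historyAt I Y t ω))) ∂P ≤ 1 := by
  induction t, ht using Nat.le_induction with
  | base =>
    have : ∀ ω, B.expo v (historyAt I Y 1 ω) = 0 := by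
      intro ω
      simp [expo, noise_historyAt, histGram_historyAt, gram, quadForm]
    simp [this]
  | succ t ht ih =>
    refine le_trans ?_ (ih (by omega))
    have hlaw := hB.reward_law t (Finset.mem_Icc.2 ⟨ht, by omega⟩)
    have hmh := measurable_historyAt hB.measurable_I hB.measurable_Y t
    have hmX : Measurable fun ω => (historyAt I Y t ω, I t ω) := hmh.prodMk (hB.measurable_I t)
    set F : (History K t × Fin K) × ℝ → ENNReal := fun p =>
      ENNReal.ofReal (Real.exp (B.expo v p.1.1)) *
        ENNReal.ofReal (Real.exp (⟪v, B.x p.1.2⟫ * (p.2 - B.meanReward p.1.2)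
        - B.σ ^ 2 / 2 * ⟪v, B.x p.1.2⟫ ^ 2))
    have hc : ∀ f : Fin K → ℝ, Measurable fun p : (History K t × Fin K) × ℝ => f p.1.2 :=
      fun f => (measurable_of_countable f).comp (measurable_snd.comp measurable_fst)
    have hF1 : Measurable fun p : (History K t × Fin K) × ℝ =>
        ENNReal.ofReal (Real.exp (B.expo v p.1.1)) :=
      (Real.measurable_exp.comp
        ((B.measurable_expo v t).comp (measurable_fst.comp measurable_fst))).ennreal_ofReal
    have hF2 : Measurable fun p : (History K t × Fin K) × ℝ =>
        ENNReal.ofReal (Real.exp (⟪v, B.x p.1.2⟫ * (p.2 - B.meanReward p.1.2)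
        - B.σ ^ 2 / 2 * ⟪v, B.x p.1.2⟫ ^ 2)) :=
      (Real.measurable_exp.comp (((hc fun i => ⟪v, B.x i⟫).mul
        (measurable_snd.sub (hc B.meanReward))).sub
        (((hc fun i => ⟪v, B.x i⟫).pow_const 2).const_mul _))).ennreal_ofReal
    have hF : Measurable F := hF1.mul hF2
    have e1 : ∀ ω, ENNReal.ofReal (Real.exp (B.expo v (historyAt I Y (t + 1) ω))) =
        F ((historyAt I Y t ω, I t ω), Y t ω) := by
      intro ω
      rw [expo_historyAt_succ B I Y v ht, Real.exp_add, ENNReal.ofReal_mul (Real.exp_pos _).le]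
    simp_rw [e1]
    rw [hlaw.lintegral_comp hF.aemeasurable, Measure.lintegral_compProd hF,
      lintegral_map hF.lintegral_kernel_prod_right' hmX]
    refine lintegral_mono fun ω => ?_
    simp only [F]
    have e2 : B.rewardKernel t (historyAt I Y t ω, I t ω) = B.reward (I t ω) := rfl
    rw [e2, lintegral_const_mul' _ _ ENNReal.ofReal_ne_top]
    exact mul_le_of_le_one_right' (B.lintegral_exp_reward_le (I t ω) v)

end GLMBandit

/-! ### Uniform concentration of the score over a grid of directions -/

theorem sqrt_quadForm_add_le {d : ℕ} {M : Matrix (Fin d) (Fin d) ℝ} (hM : M.PosDef) (u v : Vec d) :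
    √(quadForm M (u + v)) ≤ √(quadForm M u) + √(quadForm M v) := by
  have hu := hM.quadForm_nonneg u
  have hv := hM.quadForm_nonneg v
  rw [Real.sqrt_le_iff]
  refine ⟨by positivity, ?_⟩
  rw [quadForm_add_vec hM.1, add_sq, Real.sq_sqrt hu, Real.sq_sqrt hv, mul_assoc,
    ← Real.sqrt_mul hu]
  have := Real.le_sqrt_of_sq_le (dotProduct_mulVec_sq_le hM u v)
  linarith

namespace GLMBandit

variable {d K : ℕ} (B : GLMBandit d K)

/-- The point `z / √n` of the grid of mesh `1 / √n`. -/
noncomputable def gridPoint (n : ℕ) (z : Fin d → ℤ) : Vec d :=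
  WithLp.toLp 2 fun j => (z j : ℝ) / √n

/-- The exponents of all grid points in a box are below the level `y`. -/
def Concentrated (n : ℕ) (m : ℤ) (y : ℝ) {t : ℕ} (h : History K t) : Prop :=
  ∀ z ∈ Fintype.piFinset fun _ : Fin d => Finset.Icc (-m) m, B.expo (gridPoint n z) h < y

/-- Rescale u to the radius at which the exponent is tightest, then round to a grid point in a way
that does not decrease the pairing with S. Only the quadratic penalty grows, and the slack in `hy`
pays for that. The lower bound on the Gram matrix keeps the rescaled vector inside a box independent
of the history, so the grid can be fixed in advance. -/
theorem inner_noise_le_of_concentrated {n : ℕ} (hn : 0 < n) {m : ℤ} {y s κ : ℝ} {t : ℕ}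
    {h : History K t} (htn : t ≤ n) (hs : 0 < s) (hκ : 0 < κ) (hm : κ * √n ≤ m)
    (hG : ∀ u : Vec d, s ^ 2 * ‖u‖ ^ 2 ≤ (B.σ ^ 2 * κ) ^ 2 * quadForm (B.histGram h) u)
    (hy : y + s * √d + B.σ ^ 2 * d / 2 ≤ s ^ 2 / (2 * B.σ ^ 2))
    (hC : B.Concentrated n m y h) (u : Vec d) :
    ⟪u, B.noise h⟫ ≤ s * √(quadForm (B.histGram h) u) := by
  have hσ := B.σ_pos
  have hn' : (0 : ℝ) < n := by exact_mod_cast hn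
  have hsn : 0 < √(n : ℝ) := Real.sqrt_pos.2 hn'
  have hpos : ∀ u : Vec d, u ≠ 0 → 0 < quadForm (B.histGram h) u := by
    intro u hu
    have h1 := hG u
    have h2 : 0 < s ^ 2 * ‖u‖ ^ 2 := by positivity
    exact pos_of_mul_pos_right (h2.trans_le h1) (sq_nonneg _)
  have hPD : (B.histGram h).PosDef := posDef_of_quadForm_pos (B.isHermitian_histGram h) hpos
  rcases eq_or_ne u 0 with rfl | hu
  · simp [quadForm]
  set q := √(quadForm (B.histGram h) u) with hq
  have hq0 : 0 < q := Real.sqrt_pos.2 (hpos u hu)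
  have hqq : q ^ 2 = quadForm (B.histGram h) u := Real.sq_sqrt (hpos u hu).le
  -- At this radius the G-norm of w is s/σ², which maximizes ρ ↦ sρ − σ²ρ²/2. The target inequality
  -- becomes ⟨w,S⟩ ≤ s²/σ².
  set r := s / (B.σ ^ 2 * q) with hr
  have hr0 : 0 < r := by positivity
  set w : Vec d := r • u with hw
  have hQw : quadForm (B.histGram h) w = (s / B.σ ^ 2) ^ 2 := by
    rw [hw, quadForm_smul_right, ← hqq, hr]; field_simp
  have hnw : ‖w‖ ≤ κ := by
    have h1 := hG w
    rw [hQw] at h1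
    have h2 : (s * ‖w‖) ^ 2 ≤ (s * κ) ^ 2 := by
      calc (s * ‖w‖) ^ 2 = s ^ 2 * ‖w‖ ^ 2 := by ring
        _ ≤ _ := h1
        _ = _ := by field_simp
    have h3 := abs_le_of_sq_le_sq' h2 (by positivity)
    exact le_of_mul_le_mul_left h3.2 hs
  -- Each coordinate is rounded up or down according to the sign of that coordinate of S, so ⟨v,S⟩ ≥
  -- ⟨w,S⟩ without any bound on S.
  set z : Fin d → ℤ := fun j =>
    if 0 ≤ (B.noise h) j then ⌈w j * √n⌉ else ⌊w j * √n⌋ with hz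
  have hwj : ∀ j, |w j * √n| ≤ m := by
    intro j
    rw [abs_mul, abs_of_pos hsn]
    refine le_trans ?_ hm
    gcongr
    exact (by simpa using PiLp.norm_apply_le w j : |w j| ≤ ‖w‖).trans hnw
  have hzmem : z ∈ Fintype.piFinset fun _ : Fin d => Finset.Icc (-m) m := by
    rw [Fintype.mem_piFinset]
    intro j
    have h1 := abs_le.1 (hwj j)
    rw [Finset.mem_Icc]
    simp only [hz]
    split_ifs
    · constructor
      · have : ((-m : ℤ) : ℝ) ≤ ⌈w j * √n⌉ := by
          push_cast; exact h1.1.trans (Int.le_ceil _)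
        exact_mod_cast this
      · exact Int.ceil_le.2 h1.2
    · constructor
      · exact Int.le_floor.2 (by push_cast; exact h1.1)
      · have : (⌊w j * √n⌋ : ℝ) ≤ m := (Int.floor_le _).trans h1.2
        exact_mod_cast this
  set v := gridPoint n z with hv
  have hvj : ∀ j, v j = z j / √n := fun j => rfl
  have hSv : ⟪w, B.noise h⟫ ≤ ⟪v, B.noise h⟫ := by
    rw [inner_eq_dotProduct, inner_eq_dotProduct]
    refine Finset.sum_le_sum fun j _ => ?_
    rw [show v.ofLp j = z j / √n from rfl]
    simp only [hz]
    split_ifs with hS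
    · refine mul_le_mul_of_nonneg_right ?_ hS
      rw [le_div_iff₀ hsn]; exact Int.le_ceil _
    · refine mul_le_mul_of_nonpos_right ?_ (not_le.1 hS).le
      rw [div_le_iff₀ hsn]; exact Int.floor_le _
  have hej : ∀ j, |(v - w) j| ≤ 1 / √n := by
    intro j
    have h1 : (v - w) j = (z j - w j * √n) / √n := by
      simp only [PiLp.sub_apply, hvj]; field_simp
    rw [h1, abs_div, abs_of_pos hsn]
    gcongr
    simp only [hz]
    split_ifs
    · rw [abs_le]
      constructor <;> linarith [Int.le_ceil (w j * √n), Int.ceil_lt_add_one (w j * √n)]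
    · rw [abs_le]
      constructor <;> linarith [Int.floor_le (w j * √n), Int.lt_floor_add_one (w j * √n)]
  have hen : ‖v - w‖ ^ 2 ≤ d / n := by
    rw [EuclideanSpace.real_norm_sq_eq]
    calc ∑ j, (v - w) j ^ 2 ≤ ∑ _j : Fin d, 1 / (n : ℝ) := by
          refine Finset.sum_le_sum fun j _ => ?_
          rw [← sq_abs]
          calc _ ≤ (1 / √(n : ℝ)) ^ 2 := by gcongr; exact hej j
            _ = _ := by rw [div_pow, Real.sq_sqrt hn'.le]; simp
      _ = d / n := by simp [div_eq_mul_inv]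
  -- The Gram matrix is at most t ≤ n times the identity and ‖v − w‖² ≤ d/n, so mesh 1/√n costs only
  -- √d in the G-norm.
  have hQe : √(quadForm (B.histGram h) (v - w)) ≤ √d := by
    refine Real.sqrt_le_sqrt ?_
    calc _ ≤ (t : ℝ) * ‖v - w‖ ^ 2 := B.quadForm_histGram_le h _
      _ ≤ n * (d / n) := by gcongr
      _ = d := by field_simp
  have hQv : quadForm (B.histGram h) v ≤ (s / B.σ ^ 2 + √d) ^ 2 := by
    have h1 := sqrt_quadForm_add_le hPD w (v - w)
    rw [add_sub_cancel, hQw, Real.sqrt_sq (by positivity)] at h1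
    exact Real.sqrt_le_left (by positivity) |>.1 (h1.trans (by linarith))
  have hvC := hC z hzmem
  rw [expo, ← hv] at hvC
  have hfin : ⟪w, B.noise h⟫ ≤ s ^ 2 / B.σ ^ 2 := by
    have h1 : B.σ ^ 2 / 2 * quadForm (B.histGram h) v ≤
        B.σ ^ 2 / 2 * (s / B.σ ^ 2 + √d) ^ 2 := by gcongr
    have h2 : B.σ ^ 2 / 2 * (s / B.σ ^ 2 + √d) ^ 2 =
        s ^ 2 / (2 * B.σ ^ 2) + s * √d + B.σ ^ 2 * d / 2 := by
      have : (√(d : ℝ)) ^ 2 = d := Real.sq_sqrt (Nat.cast_nonneg d)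
      rw [add_sq, this]; field_simp
    have h3 : s ^ 2 / B.σ ^ 2 = s ^ 2 / (2 * B.σ ^ 2) + s ^ 2 / (2 * B.σ ^ 2) := by
      field_simp; ring
    linarith
  rw [hw, real_inner_smul_left] at hfin
  have h4 : r * (s * q) = s ^ 2 / B.σ ^ 2 := by rw [hr]; field_simp
  rw [← h4] at hfin
  exact le_of_mul_le_mul_left hfin hr0

variable {Ω : Type*} [MeasurableSpace Ω] {P : Measure Ω} [IsProbabilityMeasure P]
  {I : ℕ → Ω → Fin K} {Y : ℕ → Ω → ℝ} {n τ : ℕ} {a : ℝ} {explore : ℕ → Fin K}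
  {θhat : (t : ℕ) → History K t → Vec d} {θtilde : ℕ → Ω → Vec d}

/-- Markov's inequality for the exponential at each grid point, and a union bound over the (2m+1)^d
points of the box. -/
theorem measure_not_concentrated_le {B : GLMBandit d K}
    (hB : B.IsGLMTSL n τ a explore P I Y θhat θtilde) {m : ℤ} (hm : 0 ≤ m) (y : ℝ) {t : ℕ}
    (ht : 1 ≤ t) (htn : t ≤ n + 1) :
    P.real {ω | ¬ B.Concentrated n m y (historyAt I Y t ω)} ≤
      (2 * m + 1) ^ d * Real.exp (-y) := by
  set Z := Fintype.piFinset fun _ : Fin d => Finset.Icc (-m) m with hZ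
  have hsub : {ω | ¬ B.Concentrated n m y (historyAt I Y t ω)} ⊆
      ⋃ z ∈ Z, {ω | y ≤ B.expo (gridPoint n z) (historyAt I Y t ω)} := by
    intro ω hω
    simp only [Concentrated, Set.mem_ofPred_eq] at hω
    push Not at hω
    obtain ⟨z, hz, hzy⟩ := hω
    simp only [Set.mem_iUnion]
    exact ⟨z, hz, hzy⟩
  have hone : ∀ z, P.real {ω | y ≤ B.expo (gridPoint n z) (historyAt I Y t ω)} ≤
      Real.exp (-y) := by
    intro z
    have hmeas : Measurable fun ω =>
        ENNReal.ofReal (Real.exp (B.expo (gridPoint n z) (historyAt I Y t ω))) :=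
      (Real.measurable_exp.comp ((B.measurable_expo _ t).comp
        (measurable_historyAt hB.measurable_I hB.measurable_Y t))).ennreal_ofReal
    have h1 := meas_ge_le_lintegral_div (μ := P) hmeas.aemeasurable
      (ε := ENNReal.ofReal (Real.exp y)) (by simpa using Real.exp_pos y) ENNReal.ofReal_ne_top
    have h2 := h1.trans (ENNReal.div_le_div_right
      (lintegral_exp_expo_le hB (gridPoint n z) ht htn) _)
    have h3 : {ω | y ≤ B.expo (gridPoint n z) (historyAt I Y t ω)} ⊆
        {ω | ENNReal.ofReal (Real.exp y) ≤
          ENNReal.ofReal (Real.exp (B.expo (gridPoint n z) (historyAt I Y t ω)))} := by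
      intro ω hω
      exact ENNReal.ofReal_le_ofReal (Real.exp_le_exp.2 hω)
    have h4 := (measure_mono h3).trans h2
    rw [Measure.real]
    refine ENNReal.toReal_le_of_le_ofReal (Real.exp_pos _).le (h4.trans (le_of_eq ?_))
    rw [Real.exp_neg, ENNReal.ofReal_inv_of_pos (Real.exp_pos y), one_div]
  calc _ ≤ P.real (⋃ z ∈ Z, {ω | y ≤ B.expo (gridPoint n z) (historyAt I Y t ω)}) :=
        measureReal_mono hsub (measure_ne_top _ _)
    _ ≤ ∑ z ∈ Z, P.real {ω | y ≤ B.expo (gridPoint n z) (historyAt I Y t ω)} :=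
        measureReal_biUnion_finset_le _ _
    _ ≤ ∑ _z ∈ Z, Real.exp (-y) := Finset.sum_le_sum fun z _ => hone z
    _ = _ := by
      rw [Finset.sum_const, hZ, Fintype.card_piFinset, nsmul_eq_mul]
      simp only [Int.card_Icc, Finset.prod_const, Finset.card_univ, Fintype.card_fin]
      push_cast
      congr 2
      have : ((m + 1 - -m).toNat : ℤ) = 2 * m + 1 := by rw [Int.toNat_of_nonneg] <;> omega
      exact_mod_cast this

end GLMBandit

/-! ### Consistency of the maximum likelihood estimate -/

namespace GLMBandit

variable {d K : ℕ} (B : GLMBandit d K)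

theorem contDiff_μ : ContDiff ℝ 1 B.μ := by
  have h := B.contDiff_b
  have h2 : ContDiff ℝ (1 + 1) B.b := by simpa [one_add_one_eq_two] using h
  exact (contDiff_succ_iff_deriv.1 h2).2.2

theorem differentiable_b : Differentiable ℝ B.b := B.contDiff_b.differentiable (by norm_num)

theorem differentiable_μ : Differentiable ℝ B.μ := B.contDiff_μ.differentiable (by norm_num)

theorem continuous_deriv_μ : Continuous (deriv B.μ) := B.contDiff_μ.continuous_deriv_one

theorem deriv_μ_pos (z : ℝ) : 0 < deriv B.μ z := B.deriv_mean_pos z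

theorem strictMono_μ : StrictMono B.μ := strictMono_of_deriv_pos B.deriv_μ_pos

theorem μdotMin_le {u θ : Vec d} (hu : ‖u‖ ≤ 1) (hθ : ‖θ - B.θstar‖ ≤ 1) :
    B.μdotMin ≤ deriv B.μ ⟪u, θ⟫ := by
  refine csInf_le ⟨0, ?_⟩ ⟨u, θ, hu, hθ, rfl⟩
  rintro r ⟨u, θ, -, -, rfl⟩
  exact (B.deriv_μ_pos _).le

theorem le_μdotMax {u : Vec d} (θ : Vec d) (hu : ‖u‖ ≤ 1) : deriv B.μ ⟪u, θ⟫ ≤ B.μdotMax :=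
  le_csSup B.bddAbove_deriv_mean ⟨u, θ, hu, rfl⟩

theorem μdotMin_pos : 0 < B.μdotMin := by
  set S : Set (Vec d × Vec d) := Metric.closedBall 0 1 ×ˢ Metric.closedBall B.θstar 1
  have hS : IsCompact S := (isCompact_closedBall _ _).prod (isCompact_closedBall _ _)
  have hne : S.Nonempty := ⟨(0, B.θstar), by simp [S]⟩
  obtain ⟨p, hp, hmin⟩ := hS.exists_isMinOn hne
    (f := fun p => deriv B.μ ⟪p.1, p.2⟫)
    (B.continuous_deriv_μ.comp (continuous_fst.inner continuous_snd)).continuousOn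
  refine lt_of_lt_of_le (B.deriv_μ_pos ⟪p.1, p.2⟫) (le_csInf ?_ ?_)
  · exact ⟨_, 0, B.θstar, by simp, by simp, rfl⟩
  · rintro r ⟨u, θ, hu, hθ, rfl⟩
    refine hmin (a := (u, θ)) ?_
    simp only [S, Set.mem_prod, Metric.mem_closedBall, dist_eq_norm]
    exact ⟨by simpa using hu, hθ⟩

theorem μdotMin_le_μdotMax : B.μdotMin ≤ B.μdotMax :=
  (B.μdotMin_le (u := 0) (θ := B.θstar) (by simp) (by simp)).trans (B.le_μdotMax _ (by simp))

theorem μdotMax_pos : 0 < B.μdotMax := B.μdotMin_pos.trans_le B.μdotMin_le_μdotMax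

/-- The mean value inequality along the segment from θ_* to θ_*+D, which stays in the unit ball
where the derivative of μ is at least `μdotMin`. -/
theorem μdotMin_mul_sq_le {x D : Vec d} (hx : ‖x‖ ≤ 1) (hD : ‖D‖ ≤ 1) :
    B.μdotMin * ⟪x, D⟫ ^ 2 ≤ (B.μ ⟪x, B.θstar + D⟫ - B.μ ⟪x, B.θstar⟫) * ⟪x, D⟫ := by
  have hd : ∀ r : ℝ, HasDerivAt (fun r : ℝ => B.μ ⟪x, B.θstar + r • D⟫ * ⟪x, D⟫)
      (deriv B.μ ⟪x, B.θstar + r • D⟫ * ⟪x, D⟫ * ⟪x, D⟫) r := by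
    intro r
    have h1 : HasDerivAt (fun r : ℝ => ⟪x, B.θstar + r • D⟫) ⟪x, D⟫ r := by
      have : (fun r : ℝ => ⟪x, B.θstar + r • D⟫) = fun r : ℝ => ⟪x, B.θstar⟫ + r * ⟪x, D⟫ := by
        ext r; rw [inner_add_right, real_inner_smul_right]
      rw [this]
      simpa using ((hasDerivAt_id r).mul_const ⟪x, D⟫).const_add ⟪x, B.θstar⟫
    exact ((B.differentiable_μ _).hasDerivAt.comp r h1).mul_const _
  have h := (convex_Icc (0 : ℝ) 1).mul_sub_le_image_sub_of_le_deriv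
    (f := fun r : ℝ => B.μ ⟪x, B.θstar + r • D⟫ * ⟪x, D⟫)
    (fun r _ => (hd r).continuousAt.continuousWithinAt)
    (fun r _ => (hd r).differentiableAt.differentiableWithinAt)
    (C := B.μdotMin * ⟪x, D⟫ ^ 2) (fun r hr => by
      rw [(hd r).deriv, mul_assoc, ← pow_two]
      refine mul_le_mul_of_nonneg_right ?_ (sq_nonneg _)
      refine B.μdotMin_le hx ?_
      rw [interior_Icc] at hr
      rw [add_sub_cancel_left, norm_smul, Real.norm_of_nonneg hr.1.le]
      nlinarith [norm_nonneg D, hr.1, hr.2]) 0 (by simp) 1 (by simp) zero_le_one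
  simp only [sub_zero, mul_one, one_smul, zero_smul, add_zero] at h
  linarith

section Likelihood

variable {t : ℕ} (h : History K t)

/-- The derivative of the negative log likelihood at `θ` in the direction `D`. -/
noncomputable def dirDeriv (θ D : Vec d) : ℝ :=
  ∑ l, (B.μ ⟪B.x (h l).1, θ⟫ - (h l).2) * ⟪B.x (h l).1, D⟫

theorem hasDerivAt_negLogLik (θ D : Vec d) (r : ℝ) :
    HasDerivAt (fun r : ℝ => B.negLogLik h (θ + r • D)) (B.dirDeriv h (θ + r • D) D) r := by
  unfold negLogLik dirDeriv
  refine HasDerivAt.fun_sum fun l _ => ?_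
  have h1 : HasDerivAt (fun r : ℝ => ⟪B.x (h l).1, θ + r • D⟫) ⟪B.x (h l).1, D⟫ r := by
    have : (fun r : ℝ => ⟪B.x (h l).1, θ + r • D⟫) =
        fun r : ℝ => ⟪B.x (h l).1, θ⟫ + r * ⟪B.x (h l).1, D⟫ := by
      ext r; rw [inner_add_right, real_inner_smul_right]
    rw [this]
    simpa using ((hasDerivAt_id r).mul_const ⟪B.x (h l).1, D⟫).const_add ⟪B.x (h l).1, θ⟫
  have h2 := (((B.differentiable_b _).hasDerivAt.comp r h1).sub
    (h1.const_mul (h l).2)).sub_const (B.c (h l).2)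
  rw [sub_mul]; exact h2

theorem continuous_negLogLik : Continuous (B.negLogLik h) := by
  have := B.differentiable_b.continuous
  unfold negLogLik
  fun_prop

theorem dirDeriv_eq (θ D : Vec d) :
    B.dirDeriv h θ D =
      ∑ l, (B.μ ⟪B.x (h l).1, θ⟫ - B.μ ⟪B.x (h l).1, B.θstar⟫) * ⟪B.x (h l).1, D⟫
        - ⟪D, B.noise h⟫ := by
  simp only [dirDeriv, noise, inner_sum, ← Finset.sum_sub_distrib, real_inner_smul_right,
    real_inner_comm D, meanReward]
  refine Finset.sum_congr rfl fun l _ => by ring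

/-- Strong convexity near θ_*: the deterministic part of the directional derivative grows
quadratically in the Gram norm, and the noise enters only through the score. -/
theorem μdotMin_mul_quadForm_le {D : Vec d} (hD : ‖D‖ ≤ 1) :
    B.μdotMin * quadForm (B.histGram h) D - ⟪D, B.noise h⟫ ≤
      B.dirDeriv h (B.θstar + D) D := by
  rw [dirDeriv_eq, quadForm_histGram, Finset.mul_sum]
  refine sub_le_sub_right (Finset.sum_le_sum fun l _ => ?_) _
  exact B.μdotMin_mul_sq_le (B.norm_x_le _) hD

variable {h} {s : ℝ}

/-- On the unit sphere about θ_* the exploration bound makes q = √(DᵀGD) at least s/μ̇_min, so the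
curvature term μ̇_min q² dominates the noise term s q. -/
theorem dirDeriv_nonneg  (hS : ∀ u, ⟪u, B.noise h⟫ ≤ s * √(quadForm (B.histGram h) u))
    (hG : ∀ u, (s / B.μdotMin) ^ 2 * ‖u‖ ^ 2 ≤ quadForm (B.histGram h) u)
    {D : Vec d} (hD : ‖D‖ = 1) : 0 ≤ B.dirDeriv h (B.θstar + D) D := by
  refine le_trans ?_ (B.μdotMin_mul_quadForm_le h hD.le)
  have hm := B.μdotMin_pos
  have h1 := hG D
  rw [hD, one_pow, mul_one] at h1
  have h2 : s / B.μdotMin ≤ √(quadForm (B.histGram h) D) := Real.le_sqrt_of_sq_le h1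
  rw [div_le_iff₀ hm] at h2
  have h3 : √(quadForm (B.histGram h) D) ^ 2 = quadForm (B.histGram h) D :=
    Real.sq_sqrt ((sq_nonneg _).trans h1)
  have h4 := hS D
  have h5 := mul_le_mul_of_nonneg_right h2 (Real.sqrt_nonneg (quadForm (B.histGram h) D))
  nlinarith

/-- Along a ray from θ_* the outward derivative is nonnegative at distance one and strictly
increasing afterwards, since definiteness of the Gram matrix provides a pulled arm not orthogonal to
the ray. Hence the point of the ray on the unit sphere beats every point beyond it. This gives both
existence of a minimizer, by compactness of the ball, and its localization. -/
theorem negLogLik_lt_of_one_lt_norm  (hS : ∀ u, ⟪u, B.noise h⟫ ≤ s * √(quadForm (B.histGram h) u))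
    (hG : ∀ u, (s / B.μdotMin) ^ 2 * ‖u‖ ^ 2 ≤ quadForm (B.histGram h) u)
    (hG1 : ∀ u, ‖u‖ ^ 2 ≤ quadForm (B.histGram h) u)
    {θ : Vec d} (hθ : 1 < ‖θ - B.θstar‖) :
    ∃ θ', ‖θ' - B.θstar‖ ≤ 1 ∧ B.negLogLik h θ' < B.negLogLik h θ := by
  set R := ‖θ - B.θstar‖ with hR
  have hR0 : 0 < R := by linarith
  set D := R⁻¹ • (θ - B.θstar) with hDdef
  have hD : ‖D‖ = 1 := by
    rw [hDdef, norm_smul, norm_inv, Real.norm_of_nonneg hR0.le, ← hR, inv_mul_cancel₀ hR0.ne']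
  have h0 := B.dirDeriv_nonneg hS hG hD
  have hmono : StrictMonoOn (fun r : ℝ => B.negLogLik h (B.θstar + r • D)) (Set.Ici 1) := by
    refine strictMonoOn_of_deriv_pos (convex_Ici 1)
      (fun r _ => (B.hasDerivAt_negLogLik h _ _ r).continuousAt.continuousWithinAt) fun r hr => ?_
    rw [interior_Ici, Set.mem_Ioi] at hr
    rw [(B.hasDerivAt_negLogLik h _ _ r).deriv]
    refine lt_of_le_of_lt h0 ?_
    have hterm : ∀ x : Vec d, ⟪x, D⟫ ≠ 0 → B.μ ⟪x, B.θstar + D⟫ * ⟪x, D⟫ <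
        B.μ ⟪x, B.θstar + r • D⟫ * ⟪x, D⟫ := by
      intro x hx
      rcases lt_or_gt_of_ne hx with h1 | h1
      · refine mul_lt_mul_of_neg_right (B.strictMono_μ ?_) h1
        simp only [inner_add_right, real_inner_smul_right (r := r)]; nlinarith
      · refine mul_lt_mul_of_pos_right (B.strictMono_μ ?_) h1
        simp only [inner_add_right, real_inner_smul_right (r := r)]; nlinarith
    unfold dirDeriv
    refine Finset.sum_lt_sum (fun l _ => ?_) ?_
    · rcases eq_or_ne ⟪B.x (h l).1, D⟫ 0 with h1 | h1
      · rw [h1]; simp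
      · have := hterm _ h1; nlinarith
    · have h1 := hG1 D
      rw [hD, quadForm_histGram] at h1
      obtain ⟨l, hl, hne⟩ := Finset.exists_ne_zero_of_sum_ne_zero
        (show ∑ l, ⟪B.x (h l).1, D⟫ ^ 2 ≠ 0 by linarith)
      refine ⟨l, hl, ?_⟩
      have := hterm (B.x (h l).1) (by simpa using hne)
      nlinarith
  refine ⟨B.θstar + D, by rw [add_sub_cancel_left, hD], ?_⟩
  have h1 := hmono (by simp : (1 : ℝ) ∈ Set.Ici (1 : ℝ)) (Set.mem_Ici.2 hθ.le) hθ
  simp only [one_smul] at h1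
  have h2 : B.θstar + R • D = θ := by
    rw [hDdef, smul_smul, mul_inv_cancel₀ hR0.ne', one_smul, add_sub_cancel]
  rwa [h2] at h1

theorem exists_minimizer  (hS : ∀ u, ⟪u, B.noise h⟫ ≤ s * √(quadForm (B.histGram h) u))
    (hG : ∀ u, (s / B.μdotMin) ^ 2 * ‖u‖ ^ 2 ≤ quadForm (B.histGram h) u)
    (hG1 : ∀ u, ‖u‖ ^ 2 ≤ quadForm (B.histGram h) u) :
    ∃ θ, ∀ θ', B.negLogLik h θ ≤ B.negLogLik h θ' := by
  obtain ⟨θ, -, hmin⟩ := (isCompact_closedBall B.θstar 1).exists_isMinOn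
    ⟨B.θstar, by simp⟩ (B.continuous_negLogLik h).continuousOn
  have hball : ∀ θ', ‖θ' - B.θstar‖ ≤ 1 → B.negLogLik h θ ≤ B.negLogLik h θ' := fun θ' h' =>
    hmin (by rwa [Metric.mem_closedBall, dist_eq_norm])
  refine ⟨θ, fun θ' => ?_⟩
  rcases le_or_gt ‖θ' - B.θstar‖ 1 with h1 | h1
  · exact hball θ' h1
  · obtain ⟨θ₂, h2, h3⟩ := B.negLogLik_lt_of_one_lt_norm hS hG hG1 h1
    exact (hball θ₂ h2).trans h3.le

/-- Once the minimizer is in the unit ball, its vanishing derivative along D = θ − θ_* yields μ̇_min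
q² ≤ ⟨D,S⟩ ≤ s q, where q is the G-norm of D. -/
theorem norm_sub_le_of_minimizer  (hS : ∀ u, ⟪u, B.noise h⟫ ≤ s * √(quadForm (B.histGram h) u))
    (hG : ∀ u, (s / B.μdotMin) ^ 2 * ‖u‖ ^ 2 ≤ quadForm (B.histGram h) u)
    (hG1 : ∀ u, ‖u‖ ^ 2 ≤ quadForm (B.histGram h) u)
    {θ : Vec d} (hθ : ∀ θ', B.negLogLik h θ ≤ B.negLogLik h θ') :
    ‖θ - B.θstar‖ ≤ 1 ∧
      quadForm (B.histGram h) (θ - B.θstar) ≤ (s / B.μdotMin) ^ 2 := by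
  have hm := B.μdotMin_pos
  have hle : ‖θ - B.θstar‖ ≤ 1 := by
    by_contra hcon
    obtain ⟨θ₂, -, h3⟩ := B.negLogLik_lt_of_one_lt_norm hS hG hG1 (not_le.1 hcon)
    exact absurd (hθ θ₂) (not_le.2 h3)
  refine ⟨hle, ?_⟩
  set D := θ - B.θstar with hD
  have hd := B.hasDerivAt_negLogLik h θ D 0
  have hloc : IsLocalMin (fun r : ℝ => B.negLogLik h (θ + r • D)) 0 :=
    Eventually.of_forall fun r => by simpa using hθ _
  have hzero := hloc.hasDerivAt_eq_zero hd
  have h1 := B.μdotMin_mul_quadForm_le h hle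
  have h2 : B.θstar + D = θ + (0 : ℝ) • D := by simp [hD]
  rw [h2, hzero] at h1
  have h3 := hS D
  have hQ : 0 ≤ quadForm (B.histGram h) D := (sq_nonneg _).trans (hG1 D)
  set q := √(quadForm (B.histGram h) D)
  have hq : q ^ 2 = quadForm (B.histGram h) D := Real.sq_sqrt hQ
  rw [← hq]
  have hq0 : 0 ≤ q := Real.sqrt_nonneg _
  rcases hq0.eq_or_lt with h4 | h4
  · rw [← h4]; simpa using sq_nonneg _
  · gcongr
    rw [le_div_iff₀ hm]
    refine le_of_mul_le_mul_right ?_ h4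
    nlinarith

end Likelihood

end GLMBandit

/-! ### Concentration and anticoncentration of the sampled parameter vector -/

theorem hasSubgaussianMGF_id_gaussianReal (v : NNReal) :
    HasSubgaussianMGF (fun y : ℝ => y) v (gaussianReal 0 v) where
  integrable_exp_mul t := integrable_exp_mul_gaussianReal t
  mgf_le t := by rw [mgf_fun_id_gaussianReal]; simp

theorem gaussianReal_abs_gt_le {v : NNReal} {c L : ℝ} (hv : 0 < v) (hc : 0 ≤ c)
    (h : 2 * L * v ≤ c ^ 2) :
    (gaussianReal 0 v).real {y | c < |y|} ≤ 2 * Real.exp (-L) := by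
  have hs := hasSubgaussianMGF_id_gaussianReal v
  have hexp : Real.exp (-c ^ 2 / (2 * v)) ≤ Real.exp (-L) := by
    rw [Real.exp_le_exp, neg_div, neg_le_neg_iff, le_div_iff₀ (by positivity)]
    linarith
  have h1 := (hs.measure_ge_le hc).trans hexp
  have h2 := (hs.neg.measure_ge_le hc).trans hexp
  calc (gaussianReal 0 v).real {y | c < |y|}
      ≤ (gaussianReal 0 v).real ({y | c ≤ y} ∪ {y | c ≤ -y}) := by
        refine measureReal_mono (fun y hy => ?_) (measure_ne_top _ _)
        rcases lt_abs.1 (show c < |y| from hy) with h | h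
        · exact Or.inl h.le
        · exact Or.inr h.le
    _ ≤ _ := measureReal_union_le _ _
    _ ≤ _ := by rw [two_mul]; exact add_le_add h1 h2

/-- The probability that a standard Gaussian random variable is at least one. -/
noncomputable def gaussTail : ℝ := (gaussianReal 0 1).real (Set.Ici 1)

/-- Positivity is all that is needed of this constant: it enters the absolute constant C, and its
numerical value is never used. -/
theorem gaussTail_pos : 0 < gaussTail := by
  rw [gaussTail, Measure.real, ENNReal.toReal_pos_iff]
  refine ⟨pos_iff_ne_zero.2 fun h => ?_, measure_lt_top _ _⟩
  have := gaussianReal_absolutelyContinuous' 0 (one_ne_zero : (1 : NNReal) ≠ 0) h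
  simp at this

theorem gaussTail_le_gaussianReal {v : NNReal} {c : ℝ} (h : c ≤ √v) :
    gaussTail ≤ (gaussianReal 0 v).real {y | c ≤ y} := by
  have h1 : (gaussianReal 0 1).map (√(v : ℝ) * ·) = gaussianReal 0 v := by
    rw [gaussianReal_map_const_mul]
    congr 1
    · simp
    · ext; simp
  rw [← h1, map_measureReal_apply (by fun_prop) (measurableSet_le measurable_const measurable_id'),
    gaussTail]
  refine measureReal_mono (fun y (hy : 1 ≤ y) => ?_) (measure_ne_top _ _)
  have : 0 ≤ √(v : ℝ) := Real.sqrt_nonneg _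
  show c ≤ √(v : ℝ) * y
  nlinarith

section

variable {d : ℕ} {m : Vec d} {S : Matrix (Fin d) (Fin d) ℝ}

theorem map_inner_multivariateGaussian (hS : S.PosSemidef) (x : Vec d) :
    (multivariateGaussian m S).map (fun θ => ⟪x, θ⟫ - ⟪x, m⟫) =
      gaussianReal 0 (quadForm S x).toNNReal := by
  have h1 := IsGaussian.map_eq_gaussianReal (μ := multivariateGaussian m S) (innerSL ℝ x)
  have h2 : Var[innerSL ℝ x; multivariateGaussian m S] = quadForm S x := by
    have := covarianceBilin_self (μ := multivariateGaussian m S) IsGaussian.memLp_two_id x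
    rw [covarianceBilin_multivariateGaussian hS] at this
    exact this.symm
  have h3 : (multivariateGaussian m S)[innerSL ℝ x] = ⟪x, m⟫ := by
    rw [(innerSL ℝ x).integral_comp_id_comm IsGaussian.integrable_id]
    simp
  rw [h2, h3] at h1
  have h4 : (fun θ : Vec d => ⟪x, θ⟫ - ⟪x, m⟫) = (fun y => y - ⟪x, m⟫) ∘ (innerSL ℝ x) := rfl
  rw [h4, ← Measure.map_map (by fun_prop) (by fun_prop), h1, gaussianReal_map_sub_const, sub_self]

theorem multivariateGaussian_abs_gt_le (hS : S.PosSemidef) {x : Vec d} {c L : ℝ}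
    (hx : 0 < quadForm S x) (hc : 0 ≤ c) (h : 2 * L * quadForm S x ≤ c ^ 2) :
    (multivariateGaussian m S).real {θ | c < |⟪x, θ⟫ - ⟪x, m⟫|} ≤ 2 * Real.exp (-L) := by
  have h1 := gaussianReal_abs_gt_le (v := (quadForm S x).toNNReal) (L := L)
    (Real.toNNReal_pos.2 hx) hc (by rwa [Real.coe_toNNReal _ hx.le])
  rw [← map_inner_multivariateGaussian (m := m) hS x, map_measureReal_apply (by fun_prop)
    (measurableSet_lt measurable_const measurable_abs)] at h1
  exact h1

theorem gaussTail_le_multivariateGaussian (hS : S.PosSemidef) {x : Vec d} {c : ℝ}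
    (h : c ≤ √(quadForm S x)) :
    gaussTail ≤ (multivariateGaussian m S).real {θ | c ≤ ⟪x, θ⟫ - ⟪x, m⟫} := by
  have h1 := gaussTail_le_gaussianReal (v := (quadForm S x).toNNReal) (c := c) (by
    rw [Real.coe_toNNReal']
    exact h.trans (Real.sqrt_le_sqrt (le_max_left _ _)))
  rw [← map_inner_multivariateGaussian (m := m) hS x, map_measureReal_apply (by fun_prop)
    (measurableSet_le measurable_const measurable_id')] at h1
  exact h1

end

namespace GLMBandit

variable {d K : ℕ} (B : GLMBandit d K) {t : ℕ} {h : History K t}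

theorem quadForm_hessian (h : History K t) (θ u : Vec d) : quadForm (B.hessian h θ) u =
    ∑ l, deriv B.μ ⟪B.x (h l).1, θ⟫ * ⟪B.x (h l).1, u⟫ ^ 2 := by
  simp [hessian, quadForm_sum, quadForm_smul, quadForm_outer]

theorem quadForm_hessian_le (h : History K t) (θ u : Vec d) :
    quadForm (B.hessian h θ) u ≤ B.μdotMax * quadForm (B.histGram h) u := by
  rw [quadForm_hessian, quadForm_histGram, Finset.mul_sum]
  exact Finset.sum_le_sum fun l _ =>
    mul_le_mul_of_nonneg_right (B.le_μdotMax _ (B.norm_x_le _)) (sq_nonneg _)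

theorem le_quadForm_hessian (h : History K t) {θ : Vec d} (hθ : ‖θ - B.θstar‖ ≤ 1) (u : Vec d) :
    B.μdotMin * quadForm (B.histGram h) u ≤ quadForm (B.hessian h θ) u := by
  rw [quadForm_hessian, quadForm_histGram, Finset.mul_sum]
  exact Finset.sum_le_sum fun l _ =>
    mul_le_mul_of_nonneg_right (B.μdotMin_le (B.norm_x_le _) hθ) (sq_nonneg _)

theorem isHermitian_hessian (h : History K t) (θ : Vec d) : (B.hessian h θ).IsHermitian :=
  isHermitian_sum_smul_outer _ _ _

/-- The width `‖x_i‖_{G⁻¹}` of arm `i`. -/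
noncomputable def width (G : Matrix (Fin d) (Fin d) ℝ) (i : Fin K) : ℝ :=
  √(quadForm G⁻¹ (B.x i))

theorem posDef_histGram (hG : ∀ u, ‖u‖ ^ 2 ≤ quadForm (B.histGram h) u) :
    (B.histGram h).PosDef :=
  posDef_of_sq_norm_le (B.isHermitian_histGram h) hG

theorem posDef_hessian (hG : ∀ u, ‖u‖ ^ 2 ≤ quadForm (B.histGram h) u) {θ : Vec d}
    (hθ : ‖θ - B.θstar‖ ≤ 1) : (B.hessian h θ).PosDef :=
  posDef_of_quadForm_pos (B.isHermitian_hessian h θ) fun u hu =>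
    lt_of_lt_of_le (mul_pos B.μdotMin_pos (lt_of_lt_of_le (by positivity) (hG u)))
      (B.le_quadForm_hessian h hθ u)

theorem posSemidef_covariance (hG : ∀ u, ‖u‖ ^ 2 ≤ quadForm (B.histGram h) u) {θ : Vec d}
    (hθ : ‖θ - B.θstar‖ ≤ 1) (a : ℝ) : (a ^ 2 • (B.hessian h θ)⁻¹).PosSemidef :=
  (B.posDef_hessian hG hθ).inv.posSemidef.smul (sq_nonneg a)

theorem c₁_nonneg (n : ℕ) : 0 ≤ B.c₁ n :=
  mul_nonneg (mul_nonneg B.σ_pos.le (inv_nonneg.2 B.μdotMin_pos.le)) (Real.sqrt_nonneg _)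

theorem c₂_nonneg (n : ℕ) : 0 ≤ B.c₂ n := mul_nonneg (B.c₁_nonneg n) (Real.sqrt_nonneg _)

theorem width_nonneg (G : Matrix (Fin d) (Fin d) ℝ) (i : Fin K) : 0 ≤ B.width G i :=
  Real.sqrt_nonneg _

theorem width_sq {G : Matrix (Fin d) (Fin d) ℝ} (hG : G.PosDef) (i : Fin K) :
    B.width G i ^ 2 = quadForm G⁻¹ (B.x i) := Real.sq_sqrt (hG.inv.quadForm_nonneg _)

/-- The Hessian is at most μ̇_max G, so the factor μ̇_max in a² makes the standard deviation of the
sample at least the estimation error c₁w_i. This is what makes optimism likely. -/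
theorem c₁_mul_width_le (hG : ∀ u, ‖u‖ ^ 2 ≤ quadForm (B.histGram h) u) {θ : Vec d}
    (hθ : ‖θ - B.θstar‖ ≤ 1) (n : ℕ) (i : Fin K) :
    B.c₁ n * B.width (B.histGram h) i ≤
      √(quadForm (B.tuning n ^ 2 • (B.hessian h θ)⁻¹) (B.x i)) := by
  refine Real.le_sqrt_of_sq_le ?_
  rw [mul_pow, B.width_sq (B.posDef_histGram hG), quadForm_smul, tuning, mul_pow,
    Real.sq_sqrt B.μdotMax_pos.le, mul_assoc]
  gcongr
  exact quadForm_inv_le (B.posDef_hessian hG hθ) (B.posDef_histGram hG) B.μdotMax_pos.le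
    (B.quadForm_hessian_le h θ) (B.x i)

/-- In the other direction the Hessian is at least μ̇_min G. Thus c₂w_i is at least √(2 log(Kn))
standard deviations of the sample along x_i. -/
theorem covariance_le (hG : ∀ u, ‖u‖ ^ 2 ≤ quadForm (B.histGram h) u) {θ : Vec d}
    (hθ : ‖θ - B.θstar‖ ≤ 1) (n : ℕ) (i : Fin K) :
    quadForm (B.tuning n ^ 2 • (B.hessian h θ)⁻¹) (B.x i) ≤
      B.c₁ n ^ 2 * (B.μdotMin⁻¹ * B.μdotMax) * B.width (B.histGram h) i ^ 2 := by
  rw [B.width_sq (B.posDef_histGram hG), quadForm_smul, tuning, mul_pow,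
    Real.sq_sqrt B.μdotMax_pos.le]
  have h1 := quadForm_inv_le (B.posDef_histGram hG) (B.posDef_hessian hG hθ)
    (inv_nonneg.2 B.μdotMin_pos.le) (fun u => by
      rw [← div_eq_inv_mul, le_div_iff₀ B.μdotMin_pos, mul_comm]
      exact B.le_quadForm_hessian h hθ u) (B.x i)
  calc _ ≤ B.c₁ n ^ 2 * B.μdotMax * (B.μdotMin⁻¹ * quadForm (B.histGram h)⁻¹ (B.x i)) := by
        have := B.μdotMax_pos; gcongr
    _ = _ := by ring

/-- All arms have sampled estimates that are close to their maximum likelihood estimates. -/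
def sampleClose (n : ℕ) (θhat : History K t → Vec d) : Set (History K t × Vec d) :=
  {p | ∀ i, |⟪B.x i, p.2⟫ - ⟪B.x i, θhat p.1⟫| ≤ B.c₂ n * B.width (B.histGram p.1) i}

/-- The sampled estimate of the best arm is optimistic. -/
def optimistic (n : ℕ) (θhat : History K t → Vec d) : Set (History K t × Vec d) :=
  {p | B.c₁ n * B.width (B.histGram p.1) B.best ≤ ⟪B.x B.best, p.2⟫ - ⟪B.x B.best, θhat p.1⟫}

theorem measurable_width_fst (i : Fin K) :
    Measurable fun p : History K t × Vec d => B.width (B.histGram p.1) i :=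
  (B.measurable_comp_histGram fun M => B.width M i).comp measurable_fst

theorem measurableSet_sampleClose (n : ℕ) {θhat : History K t → Vec d} (hθ : Measurable θhat) :
    MeasurableSet (B.sampleClose n θhat) := by
  have : B.sampleClose n θhat = ⋂ i, {p : History K t × Vec d |
      |⟪B.x i, p.2⟫ - ⟪B.x i, θhat p.1⟫| ≤ B.c₂ n * B.width (B.histGram p.1) i} := by
    ext p; simp [sampleClose]
  rw [this]
  exact MeasurableSet.iInter fun i => measurableSet_le
    (measurable_abs.comp ((measurable_const.inner measurable_snd).sub
      (measurable_const.inner (hθ.comp measurable_fst))))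
    ((B.measurable_width_fst i).const_mul _)

theorem measurableSet_optimistic (n : ℕ) {θhat : History K t → Vec d} (hθ : Measurable θhat) :
    MeasurableSet (B.optimistic n θhat) :=
  measurableSet_le ((B.measurable_width_fst _).const_mul _)
    ((measurable_const.inner measurable_snd).sub
      (measurable_const.inner (hθ.comp measurable_fst)))

variable {n : ℕ} {θhat : History K t → Vec d}

theorem one_le_arms (B : GLMBandit d K) : 1 ≤ K := Fin.pos B.best

theorem measure_not_sampleClose_le (hn : 1 ≤ n) (hc : 0 < B.c₁ n)
    (hG : ∀ u, ‖u‖ ^ 2 ≤ quadForm (B.histGram h) u) (hθ : ‖θhat h - B.θstar‖ ≤ 1) :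
    (multivariateGaussian (θhat h) (B.tuning n ^ 2 • (B.hessian h (θhat h))⁻¹)).real
      {θ | (h, θ) ∉ B.sampleClose n θhat} ≤ 2 / n := by
  have hK : (1 : ℝ) ≤ K := by exact_mod_cast B.one_le_arms
  have hn' : (1 : ℝ) ≤ n := by exact_mod_cast hn
  have hM := B.μdotMax_pos
  have hm := B.μdotMin_pos
  set ν := multivariateGaussian (θhat h) (B.tuning n ^ 2 • (B.hessian h (θhat h))⁻¹) with hν
  set T : Fin K → Set (Vec d) := fun i =>
    {θ | B.c₂ n * B.width (B.histGram h) i < |⟪B.x i, θ⟫ - ⟪B.x i, θhat h⟫|} with hT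
  have hone : ∀ i, ν.real (T i) ≤ 2 / (K * n) := by
    intro i
    -- A zero feature vector has variance zero, outside the scope of the tail bound, but then the
    -- strict inequality defining `T i` cannot hold.
    rcases eq_or_ne (B.x i) 0 with h0 | h0
    · have : T i = ∅ := by
        ext θ
        simp [hT, h0, mul_nonneg (B.c₂_nonneg n) (B.width_nonneg _ i)]
      rw [this, measureReal_empty]; positivity
    · have h1 := B.covariance_le hG hθ n i
      have h2 : 0 < quadForm (B.tuning n ^ 2 • (B.hessian h (θhat h))⁻¹) (B.x i) := by
        rw [quadForm_smul]
        have := (B.posDef_hessian hG hθ).inv.quadForm_pos h0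
        have h3 : 0 < B.tuning n := mul_pos hc (Real.sqrt_pos.2 hM)
        positivity
      have hL : 0 ≤ Real.log (K * n) := Real.log_nonneg (by nlinarith)
      have h3 := multivariateGaussian_abs_gt_le (m := θhat h) (L := Real.log (K * n))
        (B.posSemidef_covariance hG hθ _) h2
        (mul_nonneg (B.c₂_nonneg n) (B.width_nonneg (B.histGram h) i)) (by
          calc _ ≤ 2 * Real.log (K * n) * _ := mul_le_mul_of_nonneg_left h1 (by positivity)
            _ = _ := by
              rw [mul_pow, c₂, mul_pow, Real.sq_sqrt (by positivity)]; ring)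
      refine h3.trans (le_of_eq ?_)
      rw [Real.exp_neg, Real.exp_log (by positivity)]; rfl
  calc ν.real {θ | (h, θ) ∉ B.sampleClose n θhat} ≤ ν.real (⋃ i, T i) := by
        refine measureReal_mono (fun θ hθ => ?_) (measure_ne_top _ _)
        simp only [sampleClose, Set.mem_ofPred_eq, not_forall, not_le] at hθ
        obtain ⟨i, hi⟩ := hθ
        exact Set.mem_iUnion.2 ⟨i, hi⟩
    _ ≤ ∑ i, ν.real (T i) := measureReal_iUnion_fintype_le _
    _ ≤ ∑ _i : Fin K, 2 / (K * n : ℝ) := Finset.sum_le_sum fun i _ => hone i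
    _ = 2 / n := by
      rw [Finset.sum_const, Finset.card_univ, Fintype.card_fin, nsmul_eq_mul]
      field_simp

theorem le_measure_optimistic_inter (hn : 1 ≤ n) (hc : 0 < B.c₁ n)
    (hG : ∀ u, ‖u‖ ^ 2 ≤ quadForm (B.histGram h) u) (hθ : ‖θhat h - B.θstar‖ ≤ 1) :
    gaussTail - 2 / n ≤
      (multivariateGaussian (θhat h) (B.tuning n ^ 2 • (B.hessian h (θhat h))⁻¹)).real
      {θ | (h, θ) ∈ B.optimistic n θhat ∩ B.sampleClose n θhat} := by
  set ν := multivariateGaussian (θhat h) (B.tuning n ^ 2 • (B.hessian h (θhat h))⁻¹) with hν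
  have h1 := B.measure_not_sampleClose_le hn hc hG hθ
  have h2 : gaussTail ≤ ν.real {θ | (h, θ) ∈ B.optimistic n θhat} :=
    gaussTail_le_multivariateGaussian (B.posSemidef_covariance hG hθ _)
      (B.c₁_mul_width_le hG hθ n B.best)
  have h3 : ν.real {θ | (h, θ) ∈ B.optimistic n θhat} ≤
      ν.real {θ | (h, θ) ∈ B.optimistic n θhat ∩ B.sampleClose n θhat} +
      ν.real {θ | (h, θ) ∉ B.sampleClose n θhat} := by
    refine (measureReal_mono (fun θ hθ => ?_) (measure_ne_top _ _)).trans
      (measureReal_union_le _ _)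
    by_cases hcl : (h, θ) ∈ B.sampleClose n θhat
    · exact Or.inl ⟨hθ, hcl⟩
    · exact Or.inr hcl
  linarith

end GLMBandit

/-! ### Integration against a conditional distribution -/

section CondDistrib

variable {Ω α β : Type*} [MeasurableSpace Ω] [MeasurableSpace α] [MeasurableSpace β]
  {P : Measure Ω} [IsProbabilityMeasure P] {X : Ω → α} {Z : Ω → β} {κ : Kernel α β}
  [IsMarkovKernel κ]

/-- If V dominates w(X) on an event of conditional probability at least p, then conditioning on X
gives E V ≥ p E w(X). With w the lead width and V the pulled width, occasional optimism controls the
lead width on average. The probability bound is asked only where w ≠ 0, that is, on good histories.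
-/
theorem mul_integral_le_integral_of_hasCondDistrib (h : HasCondDistrib Z X κ P) {w : α → ℝ}
    (hw : Measurable w) (hw0 : ∀ x, 0 ≤ w x) (hwi : Integrable (fun ω => w (X ω)) P)
    {T : Set (α × β)} (hT : MeasurableSet T) {p : ℝ} (hp0 : 0 ≤ p)
    (hp : ∀ x, w x ≠ 0 → p ≤ (κ x).real (Prod.mk x ⁻¹' T)) {V : Ω → ℝ} (hV0 : ∀ ω, 0 ≤ V ω)
    (hVi : Integrable V P) (hV : ∀ᵐ ω ∂P, (X ω, Z ω) ∈ T → w (X ω) ≤ V ω) :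
    p * ∫ ω, w (X ω) ∂P ≤ ∫ ω, V ω ∂P := by
  have hF : Measurable (T.indicator fun q : α × β => ENNReal.ofReal (w q.1)) :=
    (hw.comp measurable_fst).ennreal_ofReal.indicator hT
  rw [← ENNReal.ofReal_le_ofReal_iff (integral_nonneg hV0), ENNReal.ofReal_mul hp0,
    ofReal_integral_eq_lintegral_ofReal hwi (Eventually.of_forall fun ω => hw0 _),
    ofReal_integral_eq_lintegral_ofReal hVi (Eventually.of_forall hV0),
    ← lintegral_const_mul' _ _ ENNReal.ofReal_ne_top]
  have hX : HasLaw X (P.map X) P := ⟨h.aemeasurable_fst, rfl⟩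
  calc ∫⁻ ω, ENNReal.ofReal p * ENNReal.ofReal (w (X ω)) ∂P
      = ∫⁻ x, ENNReal.ofReal p * ENNReal.ofReal (w x) ∂(P.map X) :=
        hX.lintegral_comp (f := fun x => ENNReal.ofReal p * ENNReal.ofReal (w x))
          (hw.ennreal_ofReal.const_mul _).aemeasurable
    _ ≤ ∫⁻ x, ∫⁻ z, T.indicator (fun q : α × β => ENNReal.ofReal (w q.1)) (x, z) ∂(κ x)
          ∂(P.map X) := by
        refine lintegral_mono fun x => ?_
        have e : ∀ z, T.indicator (fun q : α × β => ENNReal.ofReal (w q.1)) (x, z) =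
            (Prod.mk x ⁻¹' T).indicator (fun _ => ENNReal.ofReal (w x)) z := fun z => rfl
        simp_rw [e]
        rw [lintegral_indicator_const (measurable_prodMk_left hT), mul_comm]
        rcases eq_or_ne (w x) 0 with h0 | h0
        · simp [h0]
        · gcongr
          exact ENNReal.ofReal_le_of_le_toReal (hp x h0)
    _ = ∫⁻ q, T.indicator (fun q : α × β => ENNReal.ofReal (w q.1)) q ∂(P.map X ⊗ₘ κ) :=
        (Measure.lintegral_compProd hF).symm
    _ = ∫⁻ ω, T.indicator (fun q : α × β => ENNReal.ofReal (w q.1)) (X ω, Z ω) ∂P :=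
        (HasLaw.lintegral_comp h hF.aemeasurable).symm
    _ ≤ ∫⁻ ω, ENNReal.ofReal (V ω) ∂P := by
        refine lintegral_mono_ae ?_
        filter_upwards [hV] with ω hω
        by_cases hm : (X ω, Z ω) ∈ T
        · rw [Set.indicator_of_mem hm]
          exact ENNReal.ofReal_le_ofReal (hω hm)
        · rw [Set.indicator_of_notMem hm]; exact zero_le

theorem measureReal_le_of_hasCondDistrib (h : HasCondDistrib Z X κ P) {T : Set (α × β)}
    (hT : MeasurableSet T) {q : ℝ} (hq0 : 0 ≤ q) (hq : ∀ x, (κ x).real (Prod.mk x ⁻¹' T) ≤ q) :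
    P.real {ω | (X ω, Z ω) ∈ T} ≤ q := by
  rw [HasLaw.measureReal_eq h (p := fun q => q ∈ T) hT, Measure.real]
  refine ENNReal.toReal_le_of_le_ofReal hq0 ?_
  rw [Set.ofPred_mem_eq, Measure.compProd_apply hT]
  have := Measure.isProbabilityMeasure_map (μ := P) h.aemeasurable_fst
  calc ∫⁻ x, κ x (Prod.mk x ⁻¹' T) ∂(P.map X) ≤ ∫⁻ _x, ENNReal.ofReal q ∂(P.map X) := by
        refine lintegral_mono fun x => ?_
        rw [← ofReal_measureReal]
        exact ENNReal.ofReal_le_ofReal (hq x)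
    _ = _ := by simp

end CondDistrib

/-! ### The regret of a single round -/

namespace GLMBandit

variable {d K : ℕ} (B : GLMBandit d K)

/-- The gap of arm `i` on the linear scale. -/
noncomputable def linGap (i : Fin K) : ℝ := ⟪B.x B.best, B.θstar⟫ - ⟪B.x i, B.θstar⟫

theorem linGap_nonneg (i : Fin K) : 0 ≤ B.linGap i := by
  rcases eq_or_ne i B.best with rfl | hi
  · simp [linGap]
  · exact sub_nonneg.2 (B.strictMono_μ.lt_iff_lt.1 (B.best_unique i hi)).le

theorem gap_best : B.gap B.best = 0 := sub_self _

theorem gap_nonneg (i : Fin K) : 0 ≤ B.gap i :=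
  sub_nonneg.2 (B.strictMono_μ.monotone (sub_nonneg.1 (B.linGap_nonneg i)))

theorem gap_le_gapMax (i : Fin K) : B.gap i ≤ B.gapMax :=
  le_ciSup (Set.finite_range B.gap).bddAbove i

theorem gapMax_nonneg : 0 ≤ B.gapMax := (B.gap_nonneg B.best).trans (B.gap_le_gapMax B.best)

theorem gap_le_linGap (i : Fin K) : B.gap i ≤ B.μdotMax * B.linGap i := by
  -- Interpolating between feature vectors, which remain in the unit ball, keeps every intermediate
  -- argument in the range over which `μdotMax` is a supremum.
  have h := (convex_Icc (0 : ℝ) 1).image_sub_le_mul_sub_of_deriv_le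
    (f := fun r : ℝ => B.μ ⟪B.x i + r • (B.x B.best - B.x i), B.θstar⟫)
    (C := B.μdotMax * B.linGap i)
  have hd : ∀ r : ℝ, HasDerivAt
      (fun r : ℝ => B.μ ⟪B.x i + r • (B.x B.best - B.x i), B.θstar⟫)
      (deriv B.μ ⟪B.x i + r • (B.x B.best - B.x i), B.θstar⟫ * B.linGap i) r := by
    intro r
    have h1 : HasDerivAt (fun r : ℝ => ⟪B.x i + r • (B.x B.best - B.x i), B.θstar⟫)
        (B.linGap i) r := by
      have : (fun r : ℝ => ⟪B.x i + r • (B.x B.best - B.x i), B.θstar⟫) =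
          fun r : ℝ => ⟪B.x i, B.θstar⟫ + r * B.linGap i := by
        ext r; rw [inner_add_left, real_inner_smul_left, inner_sub_left]; rfl
      rw [this]
      simpa using ((hasDerivAt_id r).mul_const (B.linGap i)).const_add ⟪B.x i, B.θstar⟫
    exact (B.differentiable_μ _).hasDerivAt.comp r h1
  have h2 := h (fun r _ => (hd r).continuousAt.continuousWithinAt)
    (fun r _ => (hd r).differentiableAt.differentiableWithinAt) (fun r hr => by
      rw [(hd r).deriv]
      rw [interior_Icc] at hr
      refine mul_le_mul_of_nonneg_right (B.le_μdotMax _ ?_) (B.linGap_nonneg i)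
      have h3 : B.x i + r • (B.x B.best - B.x i) = (1 - r) • B.x i + r • B.x B.best := by
        rw [smul_sub, sub_smul, one_smul]; abel
      rw [h3]
      calc _ ≤ ‖(1 - r) • B.x i‖ + ‖r • B.x B.best‖ := norm_add_le _ _
        _ = (1 - r) * ‖B.x i‖ + r * ‖B.x B.best‖ := by
          rw [norm_smul, norm_smul, Real.norm_of_nonneg hr.1.le,
            Real.norm_of_nonneg (by linarith [hr.2])]
        _ ≤ (1 - r) * 1 + r * 1 := by
          exact add_le_add (mul_le_mul_of_nonneg_left (B.norm_x_le _) (by linarith [hr.2]))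
            (mul_le_mul_of_nonneg_left (B.norm_x_le _) hr.1.le)
        _ = 1 := by ring) 0 (by simp) 1 (by simp) zero_le_one
  simpa [gap, meanReward] using h2

/-- There is a least uncertain arm among those whose gap is at most `c` times the width. -/
theorem exists_lead {c : ℝ} (hc : 0 ≤ c) (G : Matrix (Fin d) (Fin d) ℝ) :
    ∃ j, B.linGap j ≤ c * B.width G j ∧
      ∀ i, B.linGap i ≤ c * B.width G i → B.width G j ≤ B.width G i := by
  classical
  obtain ⟨j, hj, hmin⟩ := Finset.exists_min_image
    (Finset.univ.filter fun i => B.linGap i ≤ c * B.width G i) (B.width G)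
    -- The best arm has gap zero and always qualifies.
    ⟨B.best, by simpa [linGap] using mul_nonneg hc (B.width_nonneg G B.best)⟩
  exact ⟨j, by simpa using hj, fun i hi => hmin i (by simpa using hi)⟩

/-- The least width of an arm whose gap is at most `c₁ + c₂` times the width. -/
noncomputable def leadWidth (n : ℕ) (G : Matrix (Fin d) (Fin d) ℝ) : ℝ :=
  B.width G (B.exists_lead (add_nonneg (B.c₁_nonneg n) (B.c₂_nonneg n)) G).choose

theorem leadWidth_nonneg (n : ℕ) (G : Matrix (Fin d) (Fin d) ℝ) : 0 ≤ B.leadWidth n G :=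
  B.width_nonneg _ _

/-- The histories whose maximum likelihood estimate is close to the true parameter vector. -/
def goodHistory {t : ℕ} (n : ℕ) (θhat : History K t → Vec d) : Set (History K t) :=
  {h | (∀ u, ‖u‖ ^ 2 ≤ quadForm (B.histGram h) u) ∧ ‖θhat h - B.θstar‖ ≤ 1 ∧
    quadForm (B.histGram h) (θhat h - B.θstar) ≤ B.c₁ n ^ 2}

section Pointwise

variable {t n : ℕ} {θhat : History K t → Vec d} {h : History K t}

theorem measurableSet_goodHistory (hθ : Measurable θhat) :
    MeasurableSet (B.goodHistory n θhat) := by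
  have h1 : MeasurableSet {h : History K t | ∀ u, ‖u‖ ^ 2 ≤ quadForm (B.histGram h) u} :=
    (B.measurable_comp_histGram fun M => ∀ u : Vec d, ‖u‖ ^ 2 ≤ quadForm M u).setOf
  have h2 : MeasurableSet {h : History K t | ‖θhat h - B.θstar‖ ≤ 1} :=
    measurableSet_le (hθ.sub_const B.θstar).norm measurable_const
  have h3 : MeasurableSet {h : History K t |
      quadForm (B.histGram h) (θhat h - B.θstar) ≤ B.c₁ n ^ 2} := by
    refine measurableSet_le ?_ measurable_const
    simp_rw [quadForm_histGram]
    exact Finset.measurable_sum _ fun l _ =>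
      ((measurable_arm_comp B.x l).inner (hθ.sub_const B.θstar)).pow_const 2
  exact h1.inter (h2.inter h3)

theorem width_le_one (hG : ∀ u, ‖u‖ ^ 2 ≤ quadForm (B.histGram h) u) (i : Fin K) :
    B.width (B.histGram h) i ≤ 1 := by
  refine Real.sqrt_le_iff.2 ⟨zero_le_one, ?_⟩
  rw [one_pow]
  refine (quadForm_inv_le_sq_norm (B.isHermitian_histGram h) hG _).trans ?_
  exact pow_le_one₀ (norm_nonneg _) (B.norm_x_le i)

theorem abs_inner_sub_le (hh : h ∈ B.goodHistory n θhat) (i : Fin K) :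
    |⟪B.x i, θhat h⟫ - ⟪B.x i, B.θstar⟫| ≤ B.c₁ n * B.width (B.histGram h) i := by
  obtain ⟨hG, -, hQ⟩ := hh
  rw [← inner_sub_right]
  have hPD := B.posDef_histGram hG
  refine abs_le_of_sq_le_sq ?_ (mul_nonneg (B.c₁_nonneg n) (B.width_nonneg _ i))
  rw [mul_pow, B.width_sq hPD, mul_comm]
  exact (inner_sq_le_quadForm_inv hPD _ _).trans
    (mul_le_mul_of_nonneg_left hQ (hPD.inv.quadForm_nonneg _))

theorem abs_inner_sample_sub_le (hh : h ∈ B.goodHistory n θhat) {θ : Vec d}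
    (hθ : (h, θ) ∈ B.sampleClose n θhat) (i : Fin K) :
    |⟪B.x i, θ⟫ - ⟪B.x i, B.θstar⟫| ≤ (B.c₁ n + B.c₂ n) * B.width (B.histGram h) i := by
  have h1 := B.abs_inner_sub_le hh i
  have h2 := hθ i
  have h3 := abs_sub_le ⟪B.x i, θ⟫ ⟪B.x i, θhat h⟫ ⟪B.x i, B.θstar⟫
  simp only at h2
  linarith

/-- Compare through the lead arm j. Its own gap is at most c w_j with c = c₁+c₂; and since the
sample prefers k to j, the linear value of k falls short of that of j by at most c(w_j + w_k). -/
theorem linGap_le (hh : h ∈ B.goodHistory n θhat) {θ : Vec d}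
    (hθ : (h, θ) ∈ B.sampleClose n θhat) {k : Fin K} (hk : ∀ i, ⟪B.x i, θ⟫ ≤ ⟪B.x k, θ⟫) :
    B.linGap k ≤
      (B.c₁ n + B.c₂ n) * (2 * B.leadWidth n (B.histGram h) + B.width (B.histGram h) k) := by
  obtain ⟨h1, -⟩ := (B.exists_lead (add_nonneg (B.c₁_nonneg n) (B.c₂_nonneg n))
    (B.histGram h)).choose_spec
  set j := (B.exists_lead (add_nonneg (B.c₁_nonneg n) (B.c₂_nonneg n)) (B.histGram h)).choose
    with hj
  have e : B.leadWidth n (B.histGram h) = B.width (B.histGram h) j := rfl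
  rw [e]
  have hkk := abs_le.1 (B.abs_inner_sample_sub_le hh hθ k)
  have hjj := abs_le.1 (B.abs_inner_sample_sub_le hh hθ j)
  have h2 := hk j
  have h3 : B.linGap k = B.linGap j + (⟪B.x j, B.θstar⟫ - ⟪B.x k, B.θstar⟫) := by
    simp only [linGap]; ring
  rw [h3]
  linarith [hkk.1, hkk.2, hjj.1, hjj.2]

/-- Optimism lifts the sampled value of the best arm above its true value, and the pulled arm k does
at least as well in the sample. Accuracy of the sample at k then bounds the gap of k by (c₁+c₂)w_k,
so k competes in the minimum defining the lead. -/
theorem leadWidth_le (hh : h ∈ B.goodHistory n θhat) {θ : Vec d}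
    (hθ : (h, θ) ∈ B.optimistic n θhat ∩ B.sampleClose n θhat) {k : Fin K}
    (hk : ∀ i, ⟪B.x i, θ⟫ ≤ ⟪B.x k, θ⟫) :
    B.leadWidth n (B.histGram h) ≤ B.width (B.histGram h) k := by
  refine (B.exists_lead (add_nonneg (B.c₁_nonneg n) (B.c₂_nonneg n))
    (B.histGram h)).choose_spec.2 k ?_
  have h1 := abs_le.1 (B.abs_inner_sample_sub_le hh hθ.2 k)
  have h2 := abs_le.1 (B.abs_inner_sub_le hh B.best)
  have h3 : B.c₁ n * B.width (B.histGram h) B.best ≤ ⟪B.x B.best, θ⟫ - ⟪B.x B.best, θhat h⟫ :=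
    hθ.1
  have h4 := hk B.best
  simp only [linGap]
  linarith [h1.2, h2.1]

end Pointwise

section Round

variable {Ω : Type*} {I : ℕ → Ω → Fin K} {Y : ℕ → Ω → ℝ} {n τ : ℕ} {explore : ℕ → Fin K}
  {θhat : (t : ℕ) → History K t → Vec d} {θtilde : ℕ → Ω → Vec d}

/-- The width of the pulled arm in round `t`, on good histories. -/
noncomputable def pulledWidth (n : ℕ) (I : ℕ → Ω → Fin K) (Y : ℕ → Ω → ℝ)
    (θhat : (t : ℕ) → History K t → Vec d) (t : ℕ) : Ω → ℝ :=
  {ω | historyAt I Y t ω ∈ B.goodHistory n (θhat t)}.indicator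
    fun ω => B.width (B.histGram (historyAt I Y t ω)) (I t ω)

theorem pulledWidth_of_mem {t : ℕ} {ω : Ω}
    (h : historyAt I Y t ω ∈ B.goodHistory n (θhat t)) : B.pulledWidth n I Y θhat t ω =
      B.width (B.histGram (historyAt I Y t ω)) (I t ω) :=
  Set.indicator_of_mem (s := {ω | historyAt I Y t ω ∈ B.goodHistory n (θhat t)}) h _

theorem pulledWidth_nonneg (t : ℕ) (ω : Ω) : 0 ≤ B.pulledWidth n I Y θhat t ω :=
  Set.indicator_nonneg (fun _ _ => B.width_nonneg _ _) _

theorem pulledWidth_le_one (t : ℕ) (ω : Ω) : B.pulledWidth n I Y θhat t ω ≤ 1 :=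
  Set.indicator_apply_le' (fun h => B.width_le_one h.1 _) fun _ => zero_le_one

theorem pulledWidth_le_width (t : ℕ) (ω : Ω) :
    B.pulledWidth n I Y θhat t ω ≤ B.width (B.histGram (historyAt I Y t ω)) (I t ω) :=
  Set.indicator_le_self' (fun _ _ => B.width_nonneg _ _) ω

variable [MeasurableSpace Ω] {P : Measure Ω} [IsProbabilityMeasure P]

theorem integrable_pulledWidth (hI : ∀ t, Measurable (I t)) (hY : ∀ t, Measurable (Y t))
    (hθ : ∀ t, Measurable (θhat t)) (t : ℕ) : Integrable (B.pulledWidth n I Y θhat t) P := by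
  have hm : Measurable (B.pulledWidth n I Y θhat t) := by
    refine Measurable.indicator ?_
      (measurable_historyAt hI hY t (B.measurableSet_goodHistory (hθ t)))
    have h1 : Measurable fun q : (↥(Finset.Ico 1 t) → Fin K) × Fin K =>
        B.width (∑ l, outer (B.x (q.1 l))) q.2 := measurable_of_countable _
    have h2 : Measurable fun ω => (fun l : ↥(Finset.Ico 1 t) => I l ω, I t ω) :=
      (measurable_pi_lambda _ fun l : ↥(Finset.Ico 1 t) => hI l).prodMk (hI t)
    have h3 := h1.comp h2
    simpa only [Function.comp_def, histGram, historyAt] using h3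
  refine Integrable.of_bound hm.aestronglyMeasurable 1 (Eventually.of_forall fun ω => ?_)
  rw [Real.norm_of_nonneg (B.pulledWidth_nonneg t ω)]
  exact B.pulledWidth_le_one t ω

theorem integrable_gap (hI : ∀ t, Measurable (I t)) (t : ℕ) :
    Integrable (fun ω => B.gap (I t ω)) P := by
  refine Integrable.of_bound ((measurable_of_countable B.gap).comp (hI t)).aestronglyMeasurable
    B.gapMax (Eventually.of_forall fun ω => ?_)
  rw [Real.norm_of_nonneg (B.gap_nonneg _)]
  exact B.gap_le_gapMax _

/-- A bad history or an inaccurate sample costs at most the maximal gap. Otherwise the gap is at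
most μ̇_max(c₁+c₂)(2w + V), with w the lead width and V the pulled width, and E w ≤ E V/(`gaussTail`
− 2/n). -/
theorem integral_gap_le {B : GLMBandit d K}
    (hB : B.IsGLMTSL n τ (B.tuning n) explore P I Y θhat θtilde) (hc : 0 < B.c₁ n)
    (hp : 0 < gaussTail - 2 / n) {t : ℕ} (ht : t ∈ Finset.Icc 1 n) (htτ : τ < t) :
    ∫ ω, B.gap (I t ω) ∂P ≤
      B.gapMax * (P.real {ω | historyAt I Y t ω ∉ B.goodHistory n (θhat t)} + 2 / n) +
      B.μdotMax * (B.c₁ n + B.c₂ n) * (1 + 2 / (gaussTail - 2 / n)) *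
        ∫ ω, B.pulledWidth n I Y θhat t ω ∂P := by
  have hn : 1 ≤ n := (Finset.mem_Icc.1 ht).1.trans (Finset.mem_Icc.1 ht).2
  obtain ⟨κ, hκ, hlaw⟩ := hB.sampling t ht htτ
  have : IsMarkovKernel κ := ⟨fun h => by rw [hκ]; infer_instance⟩
  have hgreedy := hB.greedy t ht htτ
  set H := historyAt I Y t with hH
  have hmH : Measurable H := measurable_historyAt hB.measurable_I hB.measurable_Y t
  have hmθ := hB.measurable_θhat t
  have hGm := B.measurableSet_goodHistory (n := n) hmθ
  have hVi := B.integrable_pulledWidth (P := P) (n := n) hB.measurable_I hB.measurable_Y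
    hB.measurable_θhat t
  have hV0 := B.pulledWidth_nonneg (n := n) (I := I) (Y := Y) (θhat := θhat) t
  set V := B.pulledWidth n I Y θhat t with hV
  set w : History K t → ℝ := (B.goodHistory n (θhat t)).indicator
    fun h => B.leadWidth n (B.histGram h) with hw
  have hwm : Measurable w :=
    (B.measurable_comp_histGram fun M => B.leadWidth n M).indicator hGm
  have hw0 : ∀ h, 0 ≤ w h := fun h => Set.indicator_nonneg (fun _ _ => B.leadWidth_nonneg _ _) _
  have hw1 : ∀ h, w h ≤ 1 := fun h =>
    Set.indicator_apply_le' (fun h' => B.width_le_one h'.1 _) fun _ => zero_le_one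
  have hwi : Integrable (fun ω => w (H ω)) P :=
    Integrable.of_bound (hwm.comp hmH).aestronglyMeasurable 1 (Eventually.of_forall fun ω => by
      rw [Real.norm_of_nonneg (hw0 _)]; exact hw1 _)
  -- the exploration of the least uncertain arm
  have hlead : (gaussTail - 2 / n) * ∫ ω, w (H ω) ∂P ≤ ∫ ω, V ω ∂P := by
    refine mul_integral_le_integral_of_hasCondDistrib hlaw hwm hw0 hwi
      ((B.measurableSet_optimistic n hmθ).inter (B.measurableSet_sampleClose n hmθ)) hp.le ?_
      hV0 hVi ?_
    · intro h hne
      have hh : h ∈ B.goodHistory n (θhat t) := Set.mem_of_indicator_ne_zero hne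
      rw [hκ]
      exact B.le_measure_optimistic_inter hn hc hh.1 hh.2.1
    · filter_upwards [hgreedy] with ω hω hT
      by_cases hh : H ω ∈ B.goodHistory n (θhat t)
      · rw [hw, Set.indicator_of_mem hh, hV, B.pulledWidth_of_mem hh]
        exact B.leadWidth_le hh hT hω
      · rw [hw, Set.indicator_of_notMem hh]; exact hV0 ω
  -- failure of the concentration of the sample
  set T : Set (History K t × Vec d) := {p | p.1 ∈ B.goodHistory n (θhat t) ∧
    p ∉ B.sampleClose n (θhat t)} with hT
  have hTm : MeasurableSet T :=
    (measurable_fst hGm).inter (B.measurableSet_sampleClose n hmθ).compl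
  have hfail : P.real {ω | (H ω, θtilde t ω) ∈ T} ≤ 2 / n := by
    refine measureReal_le_of_hasCondDistrib hlaw hTm (by positivity) fun h => ?_
    by_cases hh : h ∈ B.goodHistory n (θhat t)
    · rw [hκ]
      refine le_trans (measureReal_mono (fun θ hθ => ?_) (measure_ne_top _ _))
        (B.measure_not_sampleClose_le hn hc hh.1 hh.2.1)
      exact hθ.2
    · have : Prod.mk h ⁻¹' T = ∅ := by
        ext θ; simp [hT, hh]
      rw [this, measureReal_empty]; positivity
  set F₁ : Set Ω := {ω | H ω ∉ B.goodHistory n (θhat t)} with hF₁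
  set F₂ : Set Ω := {ω | (H ω, θtilde t ω) ∈ T} with hF₂
  have hF₁m : MeasurableSet F₁ := (hmH hGm).compl
  have hF₂m : MeasurableSet F₂ := (hmH.prodMk (hB.measurable_θtilde t)) hTm
  set c := B.c₁ n + B.c₂ n with hcdef
  have hc0 : 0 ≤ c := add_nonneg (B.c₁_nonneg n) (B.c₂_nonneg n)
  have hM := B.μdotMax_pos
  have hΔ := B.gapMax_nonneg
  have hpt : ∀ᵐ ω ∂P, B.gap (I t ω) ≤ F₁.indicator (fun _ => B.gapMax) ω +
      F₂.indicator (fun _ => B.gapMax) ω + B.μdotMax * c * (2 * w (H ω) + V ω) := by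
    filter_upwards [hgreedy] with ω hω
    have i1 : 0 ≤ F₁.indicator (fun _ => B.gapMax) ω := Set.indicator_nonneg (fun _ _ => hΔ) _
    have i2 : 0 ≤ F₂.indicator (fun _ => B.gapMax) ω := Set.indicator_nonneg (fun _ _ => hΔ) _
    have i3 : 0 ≤ B.μdotMax * c * (2 * w (H ω) + V ω) :=
      mul_nonneg (mul_nonneg hM.le hc0) (by linarith [hw0 (H ω), hV0 ω])
    have i4 := B.gap_le_gapMax (I t ω)
    by_cases hh : H ω ∈ B.goodHistory n (θhat t)
    · by_cases hcl : (H ω, θtilde t ω) ∈ B.sampleClose n (θhat t)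
      · have e1 : w (H ω) = B.leadWidth n (B.histGram (H ω)) := by
          rw [hw, Set.indicator_of_mem hh]
        have e2 : V ω = B.width (B.histGram (H ω)) (I t ω) := 
          B.pulledWidth_of_mem hh
        have h1 := B.linGap_le hh hcl hω
        rw [← e1, ← e2] at h1
        have h2 := (B.gap_le_linGap (I t ω)).trans (mul_le_mul_of_nonneg_left h1 hM.le)
        rw [← mul_assoc] at h2
        linarith
      · rw [Set.indicator_of_mem (show ω ∈ F₂ from ⟨hh, hcl⟩)]
        linarith
    · rw [Set.indicator_of_mem (show ω ∈ F₁ from hh)]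
      linarith
  have j1 : Integrable (F₁.indicator fun _ => B.gapMax) P :=
    (integrable_const _).indicator hF₁m
  have j2 : Integrable (F₂.indicator fun _ => B.gapMax) P :=
    (integrable_const _).indicator hF₂m
  have j3 : Integrable (fun ω => B.μdotMax * c * (2 * w (H ω) + V ω)) P :=
    ((hwi.const_mul 2).add hVi).const_mul _
  have hint := integral_mono_ae (B.integrable_gap hB.measurable_I t) ((j1.add j2).add j3) hpt
  have e : ∫ ω, (F₁.indicator (fun _ => B.gapMax) + F₂.indicator (fun _ => B.gapMax) +
      fun ω => B.μdotMax * c * (2 * w (H ω) + V ω)) ω ∂P =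
      B.gapMax * (P.real F₁ + P.real F₂) +
        B.μdotMax * c * (2 * ∫ ω, w (H ω) ∂P + ∫ ω, V ω ∂P) := by
    rw [integral_add' (j1.add j2) j3, integral_add' j1 j2, integral_indicator_const _ hF₁m,
      integral_indicator_const _ hF₂m, integral_const_mul, integral_add (hwi.const_mul 2) hVi,
      integral_const_mul]
    simp only [smul_eq_mul]; ring
  rw [e] at hint
  refine hint.trans ?_
  have h5 : ∫ ω, w (H ω) ∂P ≤ (∫ ω, V ω ∂P) / (gaussTail - 2 / n) := by
    rw [le_div_iff₀ hp, mul_comm]; exact hlead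
  have h6 : B.μdotMax * c * (2 * ∫ ω, w (H ω) ∂P + ∫ ω, V ω ∂P) ≤
      B.μdotMax * c * (1 + 2 / (gaussTail - 2 / n)) * ∫ ω, V ω ∂P := by
    rw [mul_assoc (B.μdotMax * c)]
    refine mul_le_mul_of_nonneg_left ?_ (mul_nonneg hM.le hc0)
    calc _ ≤ 2 * ((∫ ω, V ω ∂P) / (gaussTail - 2 / n)) + ∫ ω, V ω ∂P := by gcongr
      _ = _ := by ring
  have h7 : B.gapMax * (P.real F₁ + P.real F₂) ≤ B.gapMax * (P.real F₁ + 2 / n) := by gcongr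
  exact add_le_add h7 h6

end Round

end GLMBandit

/-! ### The regret of GLM-TSL over a fixed horizon -/

namespace GLMBandit

variable {d K : ℕ} {B : GLMBandit d K}

theorem isHermitian_gram (B : GLMBandit d K) (e : ℕ → Fin K) (t : ℕ) :
    (B.gram e t).IsHermitian := by
  have := isHermitian_sum_smul_outer (Finset.Ico 1 t) (fun _ => (1 : ℝ)) fun l => B.x (e l)
  simpa [gram] using this

theorem quadForm_gram_le_of_eq (B : GLMBandit d K) {e e' : ℕ → Fin K} {τ t : ℕ} (hτt : τ ≤ t)
    (h : ∀ l ∈ Finset.Ico 1 τ, e' l = e l) (u : Vec d) :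
    quadForm (B.gram e τ) u ≤ quadForm (B.gram e' t) u := by
  simp only [gram, quadForm_sum, quadForm_outer]
  calc ∑ l ∈ Finset.Ico 1 τ, ⟪B.x (e l), u⟫ ^ 2 = ∑ l ∈ Finset.Ico 1 τ, ⟪B.x (e' l), u⟫ ^ 2 :=
        Finset.sum_congr rfl fun l hl => by rw [h l hl]
    _ ≤ _ := Finset.sum_le_sum_of_subset_of_nonneg (Finset.Ico_subset_Ico_right hτt)
        fun _ _ _ => sq_nonneg _

theorem log_det_gram_le (B : GLMBandit d K) {e : ℕ → Fin K} {n : ℕ}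
    (h : ∀ u, ‖u‖ ^ 2 ≤ quadForm (B.gram e (n + 1)) u) :
    Real.log (B.gram e (n + 1)).det ≤ d * Real.log n := by
  have hPD := posDef_of_sq_norm_le (B.isHermitian_gram e (n + 1)) h
  have htr : (B.gram e (n + 1)).trace ≤ n := by
    rw [gram, Matrix.trace_sum]
    calc ∑ l ∈ Finset.Ico 1 (n + 1), (outer (B.x (e l))).trace
        ≤ ∑ _l ∈ Finset.Ico 1 (n + 1), (1 : ℝ) := Finset.sum_le_sum fun l _ => by
          rw [trace_outer]; exact pow_le_one₀ (norm_nonneg _) (B.norm_x_le _)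
      _ = n := by simp
  have h0 := hPD.posSemidef.trace_nonneg
  rw [← Real.log_pow]
  exact Real.log_le_log hPD.det_pos
    (hPD.det_le_trace_pow.trans (pow_le_pow_left₀ h0 htr d))

variable {Ω : Type*} [MeasurableSpace Ω] {P : Measure Ω}
  {I : ℕ → Ω → Fin K} {Y : ℕ → Ω → ℝ} {n τ : ℕ} {a : ℝ} {explore : ℕ → Fin K}
  {θhat : (t : ℕ) → History K t → Vec d} {θtilde : ℕ → Ω → Vec d}

theorem ae_lambdaMin_le (hB : B.IsGLMTSL n τ a explore P I Y θhat θtilde) (hτ : τ ≤ n) :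
    ∀ᵐ ω ∂P, ∀ t, τ ≤ t → ∀ u, lambdaMin (B.gram explore τ) * ‖u‖ ^ 2 ≤
      quadForm (B.gram (fun l => I l ω) t) u := by
  have h : ∀ᵐ ω ∂P, ∀ t, t ∈ Finset.Icc 1 n → t ≤ τ → I t ω = explore t := by
    rw [ae_all_iff]
    intro t
    by_cases h1 : t ∈ Finset.Icc 1 n ∧ t ≤ τ
    · filter_upwards [hB.explore_eq t h1.1 h1.2] with ω hω _ _ using hω
    · exact Eventually.of_forall fun ω h2 h3 => absurd ⟨h2, h3⟩ h1
  filter_upwards [h] with ω hω t ht u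
  refine (lambdaMin_mul_le_quadForm (B.isHermitian_gram _ _) u).trans
    (B.quadForm_gram_le_of_eq ht (fun l hl => ?_) u)
  rw [Finset.mem_Ico] at hl
  exact hω l (Finset.mem_Icc.2 ⟨hl.1, by omega⟩) hl.2.le

variable [IsProbabilityMeasure P]

theorem regret_eq_sum_integral_gap (B : GLMBandit d K) (hI : ∀ t, Measurable (I t)) (n : ℕ) :
    B.regret P I n = ∑ t ∈ Finset.Icc 1 n, ∫ ω, B.gap (I t ω) ∂P := by
  classical
  have hint : ∀ t i, Integrable (fun ω => if I t ω = i then (1 : ℝ) else 0) P := by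
    intro t i
    refine Integrable.of_bound ((measurable_of_countable
      fun k : Fin K => if k = i then (1 : ℝ) else 0).comp (hI t)).aestronglyMeasurable 1
      (Eventually.of_forall fun ω => ?_)
    split_ifs <;> simp
  have e1 : ∀ t ω, B.gap (I t ω) = ∑ i, B.gap i * if I t ω = i then (1 : ℝ) else 0 := by
    intro t ω; simp
  have e2 : ∀ t, ∫ ω, B.gap (I t ω) ∂P =
      ∑ i, B.gap i * ∫ ω, (if I t ω = i then (1 : ℝ) else 0) ∂P := by
    intro t
    simp_rw [e1]
    rw [integral_finsetSum _ fun i _ => (hint t i).const_mul _]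
    simp_rw [integral_const_mul]
  simp_rw [e2]
  rw [Finset.sum_comm, regret, ← Finset.sum_erase_add _ _ (Finset.mem_univ B.best)]
  simp only [B.gap_best, zero_mul, Finset.sum_const_zero, add_zero]
  refine Finset.sum_congr rfl fun i _ => ?_
  rw [integral_finsetSum _ fun t _ => hint t i, Finset.mul_sum]

theorem integral_gap_le_gapMax (B : GLMBandit d K) (hI : ∀ t, Measurable (I t)) (t : ℕ) :
    ∫ ω, B.gap (I t ω) ∂P ≤ B.gapMax := by
  have := integral_mono (B.integrable_gap (P := P) hI t) (integrable_const B.gapMax)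
    fun ω => B.gap_le_gapMax (I t ω)
  simpa using this

theorem regret_le_mul_gapMax (B : GLMBandit d K) (hI : ∀ t, Measurable (I t)) (n : ℕ) :
    B.regret P I n ≤ n * B.gapMax := by
  rw [B.regret_eq_sum_integral_gap hI]
  calc _ ≤ ∑ _t ∈ Finset.Icc 1 n, B.gapMax :=
        Finset.sum_le_sum fun t _ => B.integral_gap_le_gapMax hI t
    _ = _ := by simp

/-- A pathwise bound: Cauchy–Schwarz reduces the sum of widths to the sum of their squares, which
the elliptical potential lemma controls. Exploration makes the Gram matrix at least the identity, so
no regularization is needed. -/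
theorem sum_integral_pulledWidth_le (hB : B.IsGLMTSL n τ a explore P I Y θhat θtilde)
    (hτ : τ ≤ n) (hl : 1 ≤ lambdaMin (B.gram explore τ)) :
    ∑ t ∈ Finset.Ico (τ + 1) (n + 1), ∫ ω, B.pulledWidth n I Y θhat t ω ∂P ≤
      √(2 * d * n * Real.log n) := by
  have hi := B.integrable_pulledWidth (P := P) (n := n) hB.measurable_I hB.measurable_Y
    hB.measurable_θhat
  rw [← integral_finsetSum _ fun t _ => hi t]
  have hpt : ∀ᵐ ω ∂P, ∑ t ∈ Finset.Ico (τ + 1) (n + 1), B.pulledWidth n I Y θhat t ω ≤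
      √(2 * d * n * Real.log n) := by
    filter_upwards [ae_lambdaMin_le hB hτ] with ω hω
    have hone : ∀ t, τ ≤ t → ∀ u, ‖u‖ ^ 2 ≤ quadForm (B.gram (fun l => I l ω) t) u :=
      fun t ht u => le_trans (by nlinarith [sq_nonneg ‖u‖]) (hω t ht u)
    -- The Gram matrix with index t contains rounds before t, so its rank-one recursion requires t ≥
    -- 1. Starting at τ+1 guarantees this and selects exactly the sampled rounds.
    have hpot := sum_quadForm_inv_le (B.gram fun l => I l ω) (fun t => B.x (I t ω))
      (fun t => B.norm_x_le _) (τ := τ + 1) (n := n + 1) (by omega)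
      (fun t ht => B.gram_succ _ (by omega)) (B.isHermitian_gram _)
      (fun t ht => hone t (by omega))
    have hdet := B.log_det_gram_le (hone (n + 1) (by omega))
    refine Real.le_sqrt_of_sq_le ?_
    calc (∑ t ∈ Finset.Ico (τ + 1) (n + 1), B.pulledWidth n I Y θhat t ω) ^ 2
        ≤ (Finset.Ico (τ + 1) (n + 1)).card *
            ∑ t ∈ Finset.Ico (τ + 1) (n + 1), B.pulledWidth n I Y θhat t ω ^ 2 :=
          sq_sum_le_card_mul_sum_sq
      _ ≤ n * ∑ t ∈ Finset.Ico (τ + 1) (n + 1),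
            quadForm (B.gram (fun l => I l ω) t)⁻¹ (B.x (I t ω)) := by
          refine mul_le_mul (by simp) (Finset.sum_le_sum fun t ht => ?_)
            (Finset.sum_nonneg fun t _ => sq_nonneg _) (Nat.cast_nonneg n)
          rw [Finset.mem_Ico] at ht
          have hPD := posDef_of_sq_norm_le (B.isHermitian_gram (fun l => I l ω) t)
            (hone t (by omega))
          rw [← B.width_sq hPD, ← B.histGram_historyAt I Y]
          exact pow_le_pow_left₀ (B.pulledWidth_nonneg t ω) (B.pulledWidth_le_width t ω) 2
      _ ≤ n * (2 * (d * Real.log n)) := by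
          gcongr
          exact hpot.trans (mul_le_mul_of_nonneg_left hdet zero_le_two)
      _ = _ := by ring
  have := integral_mono_ae (integrable_finsetSum _ fun t _ => hi t)
    (integrable_const (√(2 * d * n * Real.log n))) hpt
  simpa using this

/-- Almost surely, concentration on the grid forces the history to be good; the rest of the argument
is deterministic. The level `hy` is the rounding condition for s = σ√L with L = d log(n/d) + 2 log
n, where c₁ = s/μ̇_min. -/
theorem measure_not_goodHistory_le (hB : B.IsGLMTSL n τ a explore P I Y θhat θtilde)
    (hexp : B.SufficientExploration n τ explore)
    (hL : 0 < d * Real.log (n / d) + 2 * Real.log n) {m : ℤ} {y : ℝ}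
    (hm : B.μdotMin / B.σ ^ 2 * √n ≤ m)
    (hy : y + B.σ * √(d * Real.log (n / d) + 2 * Real.log n) * √d + B.σ ^ 2 * d / 2 ≤
      (d * Real.log (n / d) + 2 * Real.log n) / 2)
    {t : ℕ} (ht : t ∈ Finset.Icc 1 n) (htτ : τ < t) :
    P.real {ω | historyAt I Y t ω ∉ B.goodHistory n (θhat t)} ≤
      (2 * m + 1) ^ d * Real.exp (-y) := by
  obtain ⟨hτn, hexp⟩ := hexp
  have hσ := B.σ_pos
  have hμ := B.μdotMin_pos
  obtain ⟨ht1, htn⟩ := Finset.mem_Icc.1 ht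
  set L := d * Real.log (n / d) + 2 * Real.log n with hLdef
  set s := B.σ * √L with hs
  have hs0 : 0 < s := mul_pos hσ (Real.sqrt_pos.2 hL)
  have hs2 : s ^ 2 = B.σ ^ 2 * L := by rw [hs, mul_pow, Real.sq_sqrt hL.le]
  have hc : B.c₁ n = s / B.μdotMin := by rw [c₁, ← hLdef, hs]; field_simp
  have hm0 : 0 ≤ m := by
    have : (0 : ℝ) ≤ m := le_trans (by positivity) hm
    exact_mod_cast this
  have hae : ∀ᵐ ω ∂P, ω ∈ {ω | historyAt I Y t ω ∉ B.goodHistory n (θhat t)} →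
      ω ∈ {ω | ¬ B.Concentrated n m y (historyAt I Y t ω)} := by
    filter_upwards [ae_lambdaMin_le hB hτn, hB.mle t ht htτ] with ω hG hmle hbad hC
    refine hbad ?_
    set h := historyAt I Y t ω with hh
    have hGt := hG t htτ.le
    rw [← B.histGram_historyAt I Y, ← hh] at hGt
    have hG1 : ∀ u, ‖u‖ ^ 2 ≤ quadForm (B.histGram h) u := fun u => by
      refine le_trans ?_ (hGt u)
      have := (le_max_right _ _).trans hexp
      nlinarith [sq_nonneg ‖u‖]
    have hGs : ∀ u, (s / B.μdotMin) ^ 2 * ‖u‖ ^ 2 ≤ quadForm (B.histGram h) u := fun u => by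
      refine le_trans ?_ (hGt u)
      refine mul_le_mul_of_nonneg_right ?_ (sq_nonneg _)
      refine le_trans (le_of_eq ?_) ((le_max_left _ _).trans hexp)
      rw [div_pow, hs2]; field_simp
    -- The box radius κ = μ̇_min/σ² is dictated by σ²κ = μ̇_min, which turns the exploration bound
    -- into the hypothesis on the Gram matrix.
    have hS := B.inner_noise_le_of_concentrated (n := n) (κ := B.μdotMin / B.σ ^ 2) (by omega) htn
      hs0 (by positivity) hm (fun u => by
        have h1 := mul_le_mul_of_nonneg_left (hGs u) (sq_nonneg B.μdotMin)
        have e1 : B.μdotMin ^ 2 * ((s / B.μdotMin) ^ 2 * ‖u‖ ^ 2) = s ^ 2 * ‖u‖ ^ 2 := by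
          field_simp
        have e2 : B.σ ^ 2 * (B.μdotMin / B.σ ^ 2) = B.μdotMin := by field_simp
        rw [e2, ← e1]; exact h1) (by
        refine hy.trans (le_of_eq ?_)
        rw [hs2]; field_simp) hC
    have hmin := hmle (B.exists_minimizer hS hGs hG1)
    have hfin := B.norm_sub_le_of_minimizer hS hGs hG1 hmin
    exact ⟨hG1, hfin.1, by rw [hc]; exact hfin.2⟩
  calc _ ≤ P.real {ω | ¬ B.Concentrated n m y (historyAt I Y t ω)} :=
        ENNReal.toReal_mono (measure_ne_top _ _) (measure_mono_ae hae)
    _ ≤ _ := measure_not_concentrated_le hB hm0 y ht1 (by omega)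

theorem regret_le (hB : B.IsGLMTSL n τ (B.tuning n) explore P I Y θhat θtilde)
    (hexp : B.SufficientExploration n τ explore)
    (hL : 0 < d * Real.log (n / d) + 2 * Real.log n) {m : ℤ} {y : ℝ}
    (hm : B.μdotMin / B.σ ^ 2 * √n ≤ m)
    (hy : y + B.σ * √(d * Real.log (n / d) + 2 * Real.log n) * √d + B.σ ^ 2 * d / 2 ≤
      (d * Real.log (n / d) + 2 * Real.log n) / 2)
    (hp : 0 < gaussTail - 2 / n) :
    B.regret P I n ≤ τ * B.gapMax + n * (B.gapMax * ((2 * m + 1) ^ d * Real.exp (-y) + 2 / n)) +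
      B.μdotMax * (B.c₁ n + B.c₂ n) * (1 + 2 / (gaussTail - 2 / n)) *
        √(2 * d * n * Real.log n) := by
  have hc : 0 < B.c₁ n := mul_pos (mul_pos B.σ_pos (inv_pos.2 B.μdotMin_pos)) (Real.sqrt_pos.2 hL)
  have hτn := hexp.1
  have hΔ := B.gapMax_nonneg
  have hm0 : (0 : ℝ) ≤ m := le_trans
    (mul_nonneg (div_nonneg B.μdotMin_pos.le (sq_nonneg _)) (Real.sqrt_nonneg _)) hm
  have hA : 0 ≤ B.μdotMax * (B.c₁ n + B.c₂ n) * (1 + 2 / (gaussTail - 2 / n)) :=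
    mul_nonneg (mul_nonneg B.μdotMax_pos.le (add_nonneg (B.c₁_nonneg n) (B.c₂_nonneg n)))
      (by positivity)
  set A := B.μdotMax * (B.c₁ n + B.c₂ n) * (1 + 2 / (gaussTail - 2 / n))
  set δ := (2 * (m : ℝ) + 1) ^ d * Real.exp (-y)
  have hδ : 0 ≤ δ := by positivity
  rw [B.regret_eq_sum_integral_gap hB.measurable_I]
  have hsplit : Finset.Icc 1 n = Finset.Ico 1 (n + 1) := by ext; simp
  rw [hsplit, ← Finset.sum_Ico_consecutive _ (show 1 ≤ τ + 1 by omega)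
    (show τ + 1 ≤ n + 1 by omega)]
  have h1 : ∑ t ∈ Finset.Ico 1 (τ + 1), ∫ ω, B.gap (I t ω) ∂P ≤ τ * B.gapMax := by
    calc _ ≤ ∑ _t ∈ Finset.Ico 1 (τ + 1), B.gapMax :=
          Finset.sum_le_sum fun t _ => B.integral_gap_le_gapMax hB.measurable_I t
      _ = _ := by simp
  have h2 : ∑ t ∈ Finset.Ico (τ + 1) (n + 1), ∫ ω, B.gap (I t ω) ∂P ≤
      n * (B.gapMax * (δ + 2 / n)) + A * √(2 * d * n * Real.log n) := by
    calc _ ≤ ∑ t ∈ Finset.Ico (τ + 1) (n + 1), (B.gapMax * (δ + 2 / n) +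
            A * ∫ ω, B.pulledWidth n I Y θhat t ω ∂P) := by
          refine Finset.sum_le_sum fun t ht => ?_
          rw [Finset.mem_Ico] at ht
          have ht' : t ∈ Finset.Icc 1 n := Finset.mem_Icc.2 ⟨by omega, by omega⟩
          refine (integral_gap_le hB hc hp ht' (by omega)).trans ?_
          gcongr
          exact measure_not_goodHistory_le hB hexp hL hm hy ht' (by omega)
      _ = (n - τ : ℕ) * (B.gapMax * (δ + 2 / n)) +
            A * ∑ t ∈ Finset.Ico (τ + 1) (n + 1), ∫ ω, B.pulledWidth n I Y θhat t ω ∂P := by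
          rw [Finset.sum_add_distrib, Finset.mul_sum]; simp
      _ ≤ _ := by
          have := sum_integral_pulledWidth_le hB hτn ((le_max_right _ _).trans hexp.2)
          gcongr
          omega
  linarith

end GLMBandit

/-! ### The growth of the regret with the horizon -/

theorem tendsto_log_natCast : Tendsto (fun n : ℕ => Real.log n) atTop atTop :=
  Real.tendsto_log_atTop.comp tendsto_natCast_atTop_atTop

theorem eventually_mul_sqrt_log_add_le (c₀ c₁ : ℝ) :
    ∀ᶠ n : ℕ in atTop, c₁ * √(Real.log n) + c₀ ≤ Real.log n / 2 := by
  have h1 : Tendsto (fun n : ℕ => √(Real.log n)) atTop atTop :=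
    Real.tendsto_sqrt_atTop.comp tendsto_log_natCast
  filter_upwards [h1.eventually_ge_atTop (max 1 (2 * (|c₁| + |c₀|))),
    tendsto_log_natCast.eventually_ge_atTop 0] with n hn hlog
  have e : √(Real.log n) ^ 2 = Real.log n := Real.sq_sqrt hlog
  set x := √(Real.log n)
  have h2 := (le_max_left _ _).trans hn
  have h3 := (le_max_right _ _).trans hn
  have h4 := le_abs_self c₁
  have h5 := le_abs_self c₀
  have h6 : c₁ * x ≤ |c₁| * x := mul_le_mul_of_nonneg_right h4 (by linarith)
  have h7 : c₀ ≤ |c₀| * x := h5.trans (le_mul_of_one_le_right (abs_nonneg _) h2)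
  rw [← e]
  nlinarith

namespace GLMBandit

variable {d K : ℕ} (B : GLMBandit d K)

theorem log_term_le {n : ℕ} (hd : 1 ≤ d) (hn : 1 ≤ n) :
    d * Real.log (n / d) + 2 * Real.log n ≤ (d + 2) * Real.log n := by
  have hd' : (1 : ℝ) ≤ d := by exact_mod_cast hd
  have hn' : (1 : ℝ) ≤ n := by exact_mod_cast hn
  have : Real.log (n / d) ≤ Real.log n :=
    Real.log_le_log (by positivity) (div_le_self (by positivity) hd')
  nlinarith

/-- The right side is (d+2)/2·log n − (d/2)log d. Choosing y = (d+1)/2·log n leaves (log n)/2 for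
the constants and the rounding cost, which is only of order √(log n). -/
theorem eventually_confidence_le (hd : 1 ≤ d) : ∀ᶠ n : ℕ in atTop,
    (d + 1) / 2 * Real.log n + B.σ * √(d * Real.log (n / d) + 2 * Real.log n) * √d +
      B.σ ^ 2 * d / 2 ≤ (d * Real.log (n / d) + 2 * Real.log n) / 2 := by
  filter_upwards [eventually_mul_sqrt_log_add_le (B.σ ^ 2 * d / 2 + d / 2 * Real.log d)
    (B.σ * √(d + 2) * √d), eventually_ge_atTop 1] with n h1 hn
  have hd' : (1 : ℝ) ≤ d := by exact_mod_cast hd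
  have hn' : (1 : ℝ) ≤ n := by exact_mod_cast hn
  have hσ := B.σ_pos
  have h2 : √(d * Real.log (n / d) + 2 * Real.log n) ≤ √(d + 2) * √(Real.log n) := by
    rw [← Real.sqrt_mul (by positivity)]
    exact Real.sqrt_le_sqrt (log_term_le hd hn)
  have h3 : B.σ * √(d * Real.log (n / d) + 2 * Real.log n) * √d ≤
      B.σ * (√(d + 2) * √(Real.log n)) * √d := by gcongr
  have h4 : Real.log (n / d) = Real.log n - Real.log d :=
    Real.log_div (by positivity) (by positivity)
  rw [h4] at h3 ⊢
  linarith

/-- The grid has order n^(d/2) points and e^(−y) = n^(−(d+1)/2), leaving a factor 1/√n. -/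
theorem grid_mul_exp_le {n : ℕ} (hn : 1 ≤ n) {κ : ℝ} (hκ : 0 ≤ κ) :
    (2 * ((⌈κ * √n⌉ : ℤ) : ℝ) + 1) ^ d * Real.exp (-((d + 1) / 2 * Real.log n)) ≤
      (2 * κ + 3) ^ d / √n := by
  have hn' : (1 : ℝ) ≤ n := by exact_mod_cast hn
  have hs : 1 ≤ √(n : ℝ) := Real.one_le_sqrt.2 hn'
  have e : Real.exp (-((d + 1) / 2 * Real.log n)) = (√(n : ℝ) ^ (d + 1))⁻¹ := by
    rw [Real.exp_neg]
    congr 1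
    have : (d + 1) / 2 * Real.log n = ((d + 1 : ℕ) : ℝ) * Real.log √n := by
      rw [Real.log_sqrt (by positivity)]; push_cast; ring
    rw [this, ← Real.log_pow, Real.exp_log (by positivity)]
  have h0 : (0 : ℝ) ≤ ⌈κ * √n⌉ := le_trans (by positivity) (Int.le_ceil (κ * √n))
  have h1 : 2 * ((⌈κ * √n⌉ : ℤ) : ℝ) + 1 ≤ (2 * κ + 3) * √n := by
    have := Int.ceil_lt_add_one (κ * √n)
    nlinarith
  rw [e, ← div_eq_mul_inv, div_le_div_iff₀ (by positivity) (by positivity)]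
  calc _ ≤ ((2 * κ + 3) * √n) ^ d * √n := by gcongr
    _ = _ := by rw [mul_pow]; ring

/-- The problem-dependent factor of the regret bound. -/
noncomputable def scale : ℝ :=
  B.σ * B.μdotMin⁻¹ * B.μdotMax * √(B.μdotMin⁻¹ * B.μdotMax)

theorem scale_pos : 0 < B.scale := by
  have := B.μdotMin_pos
  have := B.μdotMax_pos
  have := B.σ_pos
  unfold scale; positivity

/-- The three square roots contribute √(3dℓ), √(4ρℓ) and √(2dnℓ), whose product is
√24·√ρ·d·√n·ℓ^(3/2) for ℓ = log n and ρ = μ̇_max/μ̇_min. Then √24 ≤ 5, ℓ^(3/2) ≤ ℓ², and c₁+c₂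
supplies a factor 2. -/
theorem leading_term_le {n : ℕ} (hd : 1 ≤ d) (hlog : 1 ≤ Real.log n) (hKn : K ≤ n) :
    B.μdotMax * (B.c₁ n + B.c₂ n) * √(2 * d * n * Real.log n) ≤
      10 * B.scale * Real.log n ^ 2 * (d * √n) := by
  have hμ := B.μdotMin_pos
  have hM := B.μdotMax_pos
  have hσ := B.σ_pos
  have hd' : (1 : ℝ) ≤ d := by exact_mod_cast hd
  have hn : 1 ≤ n := Nat.one_le_iff_ne_zero.2 fun h => by simp [h] at hlog; linarith
  have hn' : (1 : ℝ) ≤ n := by exact_mod_cast hn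
  have hK' : (1 : ℝ) ≤ K := by exact_mod_cast B.one_le_arms
  have hKn' : (K : ℝ) ≤ n := by exact_mod_cast hKn
  set ℓ := Real.log n with hℓ
  set ρ := B.μdotMin⁻¹ * B.μdotMax with hρ
  have hρ1 : 1 ≤ ρ := by
    rw [hρ, ← div_eq_inv_mul, one_le_div hμ]; exact B.μdotMin_le_μdotMax
  have hlogK : Real.log (K * n) ≤ 2 * ℓ := by
    rw [Real.log_mul (by positivity) (by positivity), two_mul]
    exact add_le_add_left (Real.log_le_log (by positivity) hKn') _
  have h1 : B.c₁ n ≤ B.σ * B.μdotMin⁻¹ * √(3 * d * ℓ) := by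
    unfold c₁
    gcongr
    refine (log_term_le hd hn).trans ?_
    gcongr
    linarith
  have h2 : B.c₂ n ≤ B.c₁ n * √(4 * ρ * ℓ) := by
    unfold c₂
    refine mul_le_mul_of_nonneg_left (Real.sqrt_le_sqrt ?_) (B.c₁_nonneg n)
    calc 2 * B.μdotMin⁻¹ * B.μdotMax * Real.log (K * n) = 2 * ρ * Real.log (K * n) := by
          rw [hρ]; ring
      _ ≤ 2 * ρ * (2 * ℓ) := by gcongr
      _ = _ := by ring
  have h3 : B.c₁ n ≤ B.c₁ n * √(4 * ρ * ℓ) :=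
    le_mul_of_one_le_right (B.c₁_nonneg n) (Real.one_le_sqrt.2 (by nlinarith))
  have h4 : B.c₁ n + B.c₂ n ≤ 2 * (B.σ * B.μdotMin⁻¹ * √(3 * d * ℓ) * √(4 * ρ * ℓ)) := by
    have : B.c₁ n * √(4 * ρ * ℓ) ≤ B.σ * B.μdotMin⁻¹ * √(3 * d * ℓ) * √(4 * ρ * ℓ) := by gcongr
    linarith
  have hsq : √(3 * d * ℓ) * √(4 * ρ * ℓ) * √(2 * d * n * ℓ) =
      √24 * √ρ * √(d ^ 2) * √n * √(ℓ ^ 3) := by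
    rw [← Real.sqrt_mul (by positivity), ← Real.sqrt_mul (by positivity),
      ← Real.sqrt_mul (by positivity), ← Real.sqrt_mul (by positivity),
      ← Real.sqrt_mul (by positivity), ← Real.sqrt_mul (by positivity)]
    congr 1; ring
  have h24 : √24 ≤ (5 : ℝ) := Real.sqrt_le_iff.2 ⟨by norm_num, by norm_num⟩
  have hℓ3 : √(ℓ ^ 3) ≤ ℓ ^ 2 := Real.sqrt_le_iff.2 ⟨by positivity, by
    rw [← pow_mul]; exact pow_le_pow_right₀ hlog (by norm_num)⟩
  calc B.μdotMax * (B.c₁ n + B.c₂ n) * √(2 * d * n * ℓ)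
      ≤ B.μdotMax * (2 * (B.σ * B.μdotMin⁻¹ * √(3 * d * ℓ) * √(4 * ρ * ℓ))) *
          √(2 * d * n * ℓ) := by gcongr
    _ = 2 * (B.σ * B.μdotMin⁻¹ * B.μdotMax) *
          (√(3 * d * ℓ) * √(4 * ρ * ℓ) * √(2 * d * n * ℓ)) := by ring
    _ = 2 * (B.σ * B.μdotMin⁻¹ * B.μdotMax) * (√24 * √ρ * d * √n * √(ℓ ^ 3)) := by
        rw [hsq, Real.sqrt_sq (by positivity)]
    _ ≤ 2 * (B.σ * B.μdotMin⁻¹ * B.μdotMax) * (5 * √ρ * d * √n * ℓ ^ 2) := by gcongr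
    _ = _ := by rw [scale, ← hρ]; ring

/-- In dimension zero all feature vectors coincide, so two arms could not have distinct means. -/
theorem one_le_dim (B : GLMBandit d K) (hK : 2 ≤ K) : 1 ≤ d := by
  by_contra h
  obtain rfl : d = 0 := by omega
  obtain ⟨i, hi⟩ : ∃ i, i ≠ B.best := by
    have : Nontrivial (Fin K) := Fin.nontrivial_iff_two_le.2 hK
    exact exists_ne B.best
  have h1 := B.best_unique i hi
  rw [Subsingleton.elim (B.x i) (B.x B.best)] at h1
  exact lt_irrefl _ h1

theorem eventually_regret_le (hK : 2 ≤ K) : ∀ᶠ n : ℕ in atTop,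
    ∀ (τ : ℕ) (explore : ℕ → Fin K)
      (Ω : Type*) [MeasurableSpace Ω] (P : Measure Ω) [IsProbabilityMeasure P]
      (I : ℕ → Ω → Fin K) (Y : ℕ → Ω → ℝ)
      (θhat : (t : ℕ) → History K t → Vec d) (θtilde : ℕ → Ω → Vec d),
    B.SufficientExploration n τ explore →
    B.IsGLMTSL n τ (B.tuning n) explore P I Y θhat θtilde →
    B.regret P I n ≤ (20 * (1 + 4 / gaussTail) + 1) * B.scale * Real.log n ^ 2 *
      (d * √(n * Real.log K)) + τ * B.gapMax := by
  have hd := B.one_le_dim hK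
  have hg := gaussTail_pos
  have hscale := B.scale_pos
  set κ := B.μdotMin / B.σ ^ 2 with hκdef
  have hκ : 0 ≤ κ := div_nonneg B.μdotMin_pos.le (sq_nonneg _)
  -- The threshold 4/`gaussTail` keeps `gaussTail` − 2/n above half of `gaussTail`. The last
  -- threshold lets log n absorb the cost Δmax((2κ+3)^d + 2)√n of failed concentration and sampling;
  -- both it and n ≥ K depend on the bandit.
  filter_upwards [B.eventually_confidence_le hd, eventually_ge_atTop 1, eventually_ge_atTop d,
    eventually_ge_atTop K, tendsto_log_natCast.eventually_ge_atTop 1,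
    tendsto_natCast_atTop_atTop.eventually_ge_atTop (4 / gaussTail),
    tendsto_log_natCast.eventually_ge_atTop (2 * (B.gapMax * ((2 * κ + 3) ^ d + 2)) / B.scale)]
    with n hconf hn hdn hKn hlog hng hΔn τ explore Ω _ P _ I Y θhat θtilde hexp hB
  have hd' : (1 : ℝ) ≤ d := by exact_mod_cast hd
  have hn' : (1 : ℝ) ≤ n := by exact_mod_cast hn
  have hdn' : (d : ℝ) ≤ n := by exact_mod_cast hdn
  have hΔ := B.gapMax_nonneg
  have hsn : 1 ≤ √(n : ℝ) := Real.one_le_sqrt.2 hn'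
  have hnn : √(n : ℝ) * √n = n := Real.mul_self_sqrt (by positivity)
  have hL : 0 < d * Real.log (n / d) + 2 * Real.log n := by
    have : 0 ≤ Real.log (n / d) := Real.log_nonneg ((one_le_div (by positivity)).2 hdn')
    have : 0 < Real.log n := by linarith
    positivity
  have hp2 : gaussTail / 2 ≤ gaussTail - 2 / n := by
    have : 2 / (n : ℝ) ≤ gaussTail / 2 := by
      rw [div_le_div_iff₀ (by positivity) two_pos]
      rw [div_le_iff₀ hg] at hng; linarith
    linarith
  have hreg := regret_le hB hexp hL (Int.le_ceil (κ * √n)) hconf (by linarith)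
  have hlead := B.leading_term_le hd hlog hKn
  have hgrid := grid_mul_exp_le (d := d) hn hκ
  set ℓ := Real.log n with hℓ
  have hK2 : (1 / 4 : ℝ) ≤ Real.log K := by
    have h1 : Real.log 2 ≤ Real.log K := Real.log_le_log two_pos (by exact_mod_cast hK)
    have := Real.log_two_gt_d9
    linarith
  -- Since K ≥ 2 gives log K ≥ 1/4, the factor √(log K) is inserted at the price of 2. This turns
  -- the leading constant 10 into 20.
  have hroot : √(n : ℝ) ≤ 2 * √(n * Real.log K) := by
    have h1 : √(n * (1 / 4 : ℝ)) ≤ √(n * Real.log K) := Real.sqrt_le_sqrt (by gcongr)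
    have h2 : √(n * (1 / 4 : ℝ)) = √n / 2 := by
      rw [Real.sqrt_mul (by positivity)]
      rw [show (1 / 4 : ℝ) = (1 / 2) ^ 2 by norm_num, Real.sqrt_sq (by norm_num)]; ring
    linarith
  have hfail : n * (B.gapMax * ((2 * ((⌈κ * √n⌉ : ℤ) : ℝ) + 1) ^ d *
      Real.exp (-((d + 1) / 2 * ℓ)) + 2 / n)) ≤ B.scale * ℓ ^ 2 * (d * √(n * Real.log K)) := by
    calc _ ≤ n * (B.gapMax * ((2 * κ + 3) ^ d / √n + 2 / n)) := by gcongr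
      _ = B.gapMax * ((2 * κ + 3) ^ d * √n + 2) := by
        have h1 : n * ((2 * κ + 3) ^ d / √n) = (2 * κ + 3) ^ d * √n := by
          rw [mul_div_assoc', div_eq_iff (by positivity), mul_assoc, hnn, mul_comm]
        have h2 : (n : ℝ) * (2 / n) = 2 := by field_simp
        calc _ = B.gapMax * (n * ((2 * κ + 3) ^ d / √n) + n * (2 / n)) := by ring
          _ = _ := by rw [h1, h2]
      _ ≤ B.gapMax * ((2 * κ + 3) ^ d * √n + 2 * √n) := by gcongr; linarith
      _ = B.gapMax * ((2 * κ + 3) ^ d + 2) * √n := by ring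
      _ ≤ (B.scale * ℓ / 2) * √n := by
        rw [div_le_iff₀ hscale] at hΔn
        gcongr
        linarith
      _ ≤ (B.scale * ℓ / 2) * (2 * √(n * Real.log K)) := by gcongr
      _ = B.scale * ℓ * (1 * √(n * Real.log K)) := by ring
      _ ≤ B.scale * ℓ ^ 2 * (d * √(n * Real.log K)) := by
        gcongr
        exact le_self_pow₀ hlog two_ne_zero
  have hmain : B.μdotMax * (B.c₁ n + B.c₂ n) * (1 + 2 / (gaussTail - 2 / n)) *
      √(2 * d * n * ℓ) ≤
      20 * (1 + 4 / gaussTail) * B.scale * ℓ ^ 2 * (d * √(n * Real.log K)) := by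
    have h1 : 1 + 2 / (gaussTail - 2 / n) ≤ 1 + 4 / gaussTail := by
      have : 2 / (gaussTail - 2 / n) ≤ 2 / (gaussTail / 2) := by gcongr
      have e : 2 / (gaussTail / 2) = 4 / gaussTail := by field_simp; norm_num
      linarith
    have h0 : 0 ≤ B.μdotMax * (B.c₁ n + B.c₂ n) * √(2 * d * n * ℓ) :=
      mul_nonneg (mul_nonneg B.μdotMax_pos.le (add_nonneg (B.c₁_nonneg n) (B.c₂_nonneg n)))
        (Real.sqrt_nonneg _)
    calc _ = (B.μdotMax * (B.c₁ n + B.c₂ n) * √(2 * d * n * ℓ)) *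
          (1 + 2 / (gaussTail - 2 / n)) := by ring
      _ ≤ (B.μdotMax * (B.c₁ n + B.c₂ n) * √(2 * d * n * ℓ)) * (1 + 4 / gaussTail) := by gcongr
      _ ≤ (10 * B.scale * ℓ ^ 2 * (d * √n)) * (1 + 4 / gaussTail) := by gcongr
      _ ≤ (10 * B.scale * ℓ ^ 2 * (d * (2 * √(n * Real.log K)))) * (1 + 4 / gaussTail) := by
        gcongr
      _ = _ := by ring
  calc _ ≤ _ := hreg
    _ ≤ τ * B.gapMax + B.scale * ℓ ^ 2 * (d * √(n * Real.log K)) +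
        20 * (1 + 4 / gaussTail) * B.scale * ℓ ^ 2 * (d * √(n * Real.log K)) := by gcongr
    _ = _ := by ring

theorem regret_eq_zero_of_arms_le_one (hK : K ≤ 1) {Ω : Type*} [MeasurableSpace Ω]
    (P : Measure Ω) (I : ℕ → Ω → Fin K) (n : ℕ) : B.regret P I n = 0 := by
  have : Subsingleton (Fin K) := Fin.subsingleton_iff_le_one.2 hK
  refine Finset.sum_eq_zero fun i hi =>
    absurd (Subsingleton.elim i B.best) (Finset.ne_of_mem_erase hi)

end GLMBandit

/-! ### Assembly of the two claims -/

theorem mainTheorem1 :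
    (∀ (d K : ℕ) (B : GLMBandit d K) (n τ : ℕ) (explore : ℕ → Fin K)
        (Ω : Type*) [MeasurableSpace Ω] (P : Measure Ω) [IsProbabilityMeasure P]
        (I : ℕ → Ω → Fin K) (Y : ℕ → Ω → ℝ)
        (θhat : (t : ℕ) → History K t → Vec d) (θtilde : ℕ → Ω → Vec d),
      (1 : ℝ) / n < 0.15 →
      B.SufficientExploration n τ explore →
      B.IsGLMTSL n τ (B.tuning n) explore P I Y θhat θtilde →
      B.regret P I n ≤
        B.μdotMax * (B.c₁ n + B.c₂ n) * (1 + 2 / (0.15 - 1 / n)) *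
            √(2 * d * n * Real.log (2 * n / d)) +
          (3 * n + τ) * B.gapMax) ∧
    (∃ C : ℝ, ∃ p : ℕ, ∀ (d K : ℕ) (B : GLMBandit d K), ∀ᶠ n : ℕ in atTop,
      ∀ (τ : ℕ) (explore : ℕ → Fin K)
        (Ω : Type*) [MeasurableSpace Ω] (P : Measure Ω) [IsProbabilityMeasure P]
        (I : ℕ → Ω → Fin K) (Y : ℕ → Ω → ℝ)
        (θhat : (t : ℕ) → History K t → Vec d) (θtilde : ℕ → Ω → Vec d),
      B.SufficientExploration n τ explore →
      B.IsGLMTSL n τ (B.tuning n) explore P I Y θhat θtilde →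
      B.regret P I n ≤
        C * (B.σ * B.μdotMin⁻¹ * B.μdotMax * √(B.μdotMin⁻¹ * B.μdotMax)) *
            Real.log n ^ p * (d * √(n * Real.log K)) +
          τ * B.gapMax) := by
  refine ⟨?_, 20 * (1 + 4 / gaussTail) + 1, 2, fun d K B => ?_⟩
  · intro d K B n τ explore Ω _ P _ I Y θhat θtilde hn hexp hB
    -- The trivial bound nΔmax is already below the additive term 3nΔmax, so the leading term only
    -- has to be nonnegative.
    have h1 := B.regret_le_mul_gapMax (P := P) hB.measurable_I n
    have h2 : 0 ≤ B.μdotMax * (B.c₁ n + B.c₂ n) * (1 + 2 / (0.15 - 1 / n)) *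
        √(2 * d * n * Real.log (2 * n / d)) := by
      have h3 : 0 ≤ 1 + 2 / (0.15 - 1 / (n : ℝ)) :=
        add_nonneg zero_le_one (div_nonneg zero_le_two (sub_pos.2 hn).le)
      exact mul_nonneg (mul_nonneg (mul_nonneg B.μdotMax_pos.le
        (add_nonneg (B.c₁_nonneg n) (B.c₂_nonneg n))) h3) (Real.sqrt_nonneg _)
    have h3 : (n : ℝ) * B.gapMax ≤ (3 * n + τ) * B.gapMax := by
      refine mul_le_mul_of_nonneg_right ?_ B.gapMax_nonneg
      have : (0 : ℝ) ≤ n := Nat.cast_nonneg n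
      have : (0 : ℝ) ≤ τ := Nat.cast_nonneg τ
      linarith
    linarith
  -- With a single arm log K = 0 and the leading term vanishes, but so does the regret.
  · rcases le_or_gt K 1 with hK | hK
    · have hK1 : (K : ℝ) = 1 := by exact_mod_cast le_antisymm hK B.one_le_arms
      refine Eventually.of_forall fun n τ explore Ω _ P _ I Y θhat θtilde _ _ => ?_
      rw [B.regret_eq_zero_of_arms_le_one hK, hK1]
      simpa using mul_nonneg (Nat.cast_nonneg τ) B.gapMax_nonneg
    · exact B.eventually_regret_le hK
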